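/- Let $R$ be a commutative ring. All $A_\infty$-categories below are small, $R$-linear, $\mathbb Z$-graded, flat ($m^0=0$) and strictly unital, and all $A_\infty$-functors are strictly unital. Explicitly, an $A_\infty$-category $\mathscr A$ has graded $R$-modules $\mathscr A(x,y)$ and multilinear operations $m^n$ ($n\ge 1$) of degree $2-n$ on composable strings with $$\sum_{k,d}(-1)^{\deg f_1+\dots+\deg f_d-d}\,m^{n-k+1}\big(f_n,\dots,m^{k}(f_{d+k},\dots,f_{d+1}),f_d,\dots,f_1\big)=0,$$ and degree-$0$ units $1_x\in\mathscr A(x,x)$ with $m^2(f,1)=f$, $m^2(1,f)=(-1)^{\deg f}f$, $m^n(\dots,1,\dots)=0$ for $n\neq2$. An $A_\infty$-functor $\mathscr F:\mathscr A\to\mathscr B$ is a map $\mathscr F^0$ on objects together with multilinear maps $\mathscr F^n$ ($n\ge1$) of degree $1-n$ such that $$\sum_{i_1+\dots+i_r=n,\;i_j\ge1} m_{\mathscr B}^r\big(\mathscr F^{i_r}(f_n,\dots),\dots,\mathscr F^{i_1}(f_{i_1},\dots,f_1)\big)=\sum_{k,d}(-1)^{\deg f_1+\dots+\deg f_d-d}\mathscr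 F^{n-k+1}\big(f_n,\dots,m_{\mathscr A}^k(f_{d+k},\dots,f_{d+1}),f_d,\dots,f_1\big),$$ $\mathscr F^1(1_x)=1_{\mathscr F^0(x)}$, and $\mathscr F^n(\dots,1,\dots)=0$ for $n\ge2$. Composition is $(\mathscr G\cdot\mathscr F)^n(f_n,\dots,f_1)=\sum \mathscr G^r(\mathscr F^{i_r}(f_n,\dots),\dots,\mathscr F^{i_1}(f_{i_1},\dots,f_1))$. Write $H(\mathscr A)$ for the graded category obtained by taking cohomology with respect to $m^1$, $H^0(\mathscr A)$ for its degree-$0$ part, and $[\mathscr F]$ for the functor that $\mathscr F$ induces. The functor $\mathscr F$ satisfies (F1) if every $\mathscr F^1:\mathscr A(x,y)\to\mathscr B(\mathscr F^0x,\mathscr F^0y)$ is a split surjection of graded $R$-modules. It satisfies (F2) if $[\mathscr F]:H^0(\mathscr A)\to H^0(\mathscr B)$ is an isofibration: every isomorphism $\varphi:\mathscr F^0(x)\to b$ in $H^0(\mathscr B)$ is the image of an isomorphism $x\to x'$ in $H^0(\mathscr A)$ with $\mathscr F^0(x')=b$. It is a quasi-equivalence if $[\mathscr F]:H(\mathscr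 A)\to H(\mathscr B)$ is an equivalence of graded categories, i.e. it is bijective on morphisms of every degree, and every object of $\mathscr B$ is isomorphic in $H^0(\mathscr B)$ to some $\mathscr F^0(x)$. **Theorem C.** Let $\mathscr F:\mathscr A\to\mathscr A'$ and $\mathscr G:\mathscr A''\to\mathscr A'$ be $A_\infty$-functors such that $\mathscr F$ satisfies (F1), and let $(\mathscr P,\ \alpha:\mathscr P\to\mathscr A'',\ \beta:\mathscr P\to\mathscr A)$ be a pullback of $\mathscr F$ and $\mathscr G$ in the category of strictly unital flat $A_\infty$-categories and strictly unital $A_\infty$-functors. Then: (i) If $\mathscr F$ satisfies (F2), then $\alpha$ satisfies (F2). (ii) If $\mathscr F$ satisfies (F2) and is a quasi-equivalence, then $\alpha$ is a quasi-equivalence. -/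

import Mathlib

open CategoryTheory

universe u v

namespace AInfinity

/-- A functor is an isofibration if every isomorphism `φ : F x ≅ b` is the image of an isomorphism
`ψ : x ≅ x'` with `F x' = b`. -/
def IsIsofibration {C D : Type*} [Category C] [Category D] (F : C ⥤ D) : Prop :=
  ∀ (x : C) (b : D) (φ : F.obj x ≅ b), ∃ (x' : C) (ψ : x ≅ x') (h : F.obj x' = b),
    F.map ψ.hom ≫ eqToHom h = φ.hom

/-! ### Strings of composable arrows -/

/-- Finite strings of composable elements of a family `H`.  The string
`cons f₁ (cons f₂ (… (cons fₙ (nil _))))` with `fᵢ : H xᵢ₋₁ xᵢ` is the one that is usually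
written `(fₙ, …, f₁)`; the arrow to be applied first is listed first. -/
inductive Chain {V : Type*} (H : V → V → Type*) : V → V → Type _
  | nil (x : V) : Chain H x x
  | cons {x y z : V} (f : H x y) (p : Chain H y z) : Chain H x z

namespace Chain

variable {V W : Type*} {H : V → V → Type*} {K : W → W → Type*}

/-- The number of arrows of a string. -/
def length : {x y : V} → Chain H x y → ℕ
  | _, _, nil _ => 0
  | _, _, cons _ p => p.length + 1

/-- Concatenation: `append a b` runs through `a` first and then through `b`. -/
def append : {x y z : V} → Chain H x y → Chain H y z → Chain H x z
  | _, _, _, nil _, q => q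
  | _, _, _, cons f p, q => cons f (append p q)

/-- The string with one arrow. -/
def single {x y : V} (f : H x y) : Chain H x y := cons f (nil y)

/-- Apply a map to every arrow of a string. -/
def map (o : V → W) (φ : ∀ {x y : V}, H x y → K (o x) (o y)) :
    {x y : V} → Chain H x y → Chain K (o x) (o y)
  | _, _, nil x => nil (o x)
  | _, _, cons f p => cons (φ f) (map o φ p)

/-- All ways to write a string as a concatenation of two (possibly empty) strings. -/
def splits : {x z : V} → Chain H x z → List (Σ y : V, Chain H x y × Chain H y z)
  | _, _, nil x => [⟨x, nil x, nil x⟩]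
  | x, _, cons f p =>
      ⟨x, nil x, cons f p⟩ :: (splits p).map fun s => ⟨s.1, cons f s.2.1, s.2.2⟩

/-- A decomposition of a string into three consecutive (possibly empty) pieces. -/
structure Split₃ (H : V → V → Type*) (x w : V) where
  /-- the first cutting point -/
  y : V
  /-- the second cutting point -/
  z : V
  /-- the arrows that come first -/
  fst : Chain H x y
  /-- the block in the middle -/
  mid : Chain H y z
  /-- the arrows that come last -/
  lst : Chain H z w

/-- All ways to write a string as a concatenation of three (possibly empty) strings. -/
def splits₃ {x w : V} (p : Chain H x w) : List (Split₃ H x w) :=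
  (splits p).flatMap fun s => (splits s.2.2).map fun t => ⟨s.1, t.1, s.2.1, t.2.1, t.2.2⟩

/-- Put one more arrow into the first block of a string of blocks (there is nothing to do if
there is no block). -/
def growFirst {x y : V} (f : H x y) : {z : V} → Chain (Chain H) y z → List (Chain (Chain H) x z)
  | _, nil _ => []
  | _, cons b c => [cons (cons f b) c]

/-- All ways to cut a string into consecutive *nonempty* blocks. -/
def cuts : {x z : V} → Chain H x z → List (Chain (Chain H) x z)
  | _, _, nil x => [nil x]
  | _, _, cons f p => (cuts p).flatMap fun c => cons (single f) c :: growFirst f c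

end Chain

/-! ### Graded quivers and formal morphisms -/

/-- A graded quiver over `R`: a set of objects and, for every pair of objects, a `ℤ`-graded
`R`-module `Hom x y`, the internal direct sum of its homogeneous parts `gr x y n`. -/
structure GradedQuiver (R : Type v) [CommRing R] where
  /-- the objects -/
  Ob : Type u
  /-- the underlying modules of morphisms -/
  Hom : Ob → Ob → Type v
  [addCommGroup : ∀ x y, AddCommGroup (Hom x y)]
  [module : ∀ x y, Module R (Hom x y)]
  /-- the homogeneous parts -/
  gr : ∀ x y, ℤ → Submodule R (Hom x y)
  isInternal : ∀ x y, DirectSum.IsInternal (gr x y)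

attribute [instance] GradedQuiver.addCommGroup GradedQuiver.module

variable {R : Type v} [CommRing R]

namespace GradedQuiver

variable (Q : GradedQuiver.{u, v} R)

/-- Homogeneous elements of `Hom x y`, together with a degree. -/
abbrev HomogHom (x y : Q.Ob) : Type v := Σ n : ℤ, Q.gr x y n

/-- Strings of composable homogeneous elements. -/
abbrev HChain (x y : Q.Ob) := Chain Q.HomogHom x y

variable {Q}

/-- The sum of the degrees of the elements of a string. -/
def degree : {x y : Q.Ob} → Q.HChain x y → ℤ
  | _, _, .nil _ => 0
  | _, _, .cons f p => f.1 + degree p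

/-- Linearity in each entry of a function of strings of homogeneous elements from `x` to `w`.
Since a graded module is the direct sum of its homogeneous parts, such functions are the same
as families of linear maps, one on `Q(xₙ₋₁,xₙ) ⊗ … ⊗ Q(x₀,x₁)` for every sequence of objects
`x = x₀, …, xₙ = w`. -/
def IsMultilinear {x w : Q.Ob} {M : Type v} [AddCommGroup M] [Module R M]
    (φ : Q.HChain x w → M) : Prop :=
  ∀ {y z : Q.Ob} (a : Q.HChain x y) (n : ℤ) (r : R) (f g : Q.gr y z n) (c : Q.HChain z w),
    φ (a.append (.cons ⟨n, r • f + g⟩ c)) =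
      r • φ (a.append (.cons ⟨n, f⟩ c)) + φ (a.append (.cons ⟨n, g⟩ c))

end GradedQuiver

open GradedQuiver

/-- A formal morphism of graded quivers: a map on objects and, for all `n ≥ 1`, multilinear maps
`Fⁿ` of degree `1 - n` on strings of length `n`.  All the `Fⁿ` are collected in `map`; there is
no component on the empty string, and we let `map` vanish there. -/
structure FormalMorphism (P Q : GradedQuiver.{u, v} R) where
  /-- the map on objects -/
  obj : P.Ob → Q.Ob
  /-- the maps `Fⁿ` -/
  map : ∀ {x y : P.Ob}, P.HChain x y → Q.Hom (obj x) (obj y)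
  map_nil : ∀ x, map (.nil x) = 0
  map_mem : ∀ {x y : P.Ob} (p : P.HChain x y),
    map p ∈ Q.gr (obj x) (obj y) (degree p + 1 - p.length)
  map_multilinear : ∀ x y : P.Ob, IsMultilinear (fun p : P.HChain x y => map p)

namespace FormalMorphism

variable {P Q S : GradedQuiver.{u, v} R}

/-- The value of a formal morphism on a string, as a homogeneous element. -/
def hmap (F : FormalMorphism P Q) {x y : P.Ob} (p : P.HChain x y) :
    Q.HomogHom (F.obj x) (F.obj y) :=
  ⟨degree p + 1 - p.length, F.map p, F.map_mem p⟩

/-- From a string of blocks `(b_r, …, b_1)` to the string `(F(b_r), …, F(b_1))`. -/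
def blocks (F : FormalMorphism P Q) {x y : P.Ob} (c : Chain P.HChain x y) :
    Q.HChain (F.obj x) (F.obj y) :=
  c.map F.obj F.hmap

/-- The linear part `F¹`, in degree `n`. -/
def lin (F : FormalMorphism P Q) (x y : P.Ob) (n : ℤ) :
    P.gr x y n →ₗ[R] Q.gr (F.obj x) (F.obj y) n where
  toFun f := ⟨F.map (.single ⟨n, f⟩), by
    have h := F.map_mem (Chain.single (⟨n, f⟩ : P.HomogHom x y))
    simpa [Chain.single, degree, Chain.length] using h⟩
  map_add' f g := by
    have h := F.map_multilinear x y (.nil x) n 1 f g (.nil y)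
    ext
    simpa [Chain.append, Chain.single] using h
  map_smul' r f := by
    have h0 := F.map_multilinear x y (.nil x) n 1 0 0 (.nil y)
    have h := F.map_multilinear x y (.nil x) n r f 0 (.nil y)
    simp only [Chain.append, one_smul, add_zero, left_eq_add] at h0 h
    ext
    simpa [Chain.single, h0] using h

theorem degree_append {x y z : P.Ob} (a : P.HChain x y) (b : P.HChain y z) :
    degree (a.append b) = degree a + degree b := by
  induction a with
  | nil x => simp [Chain.append, degree]
  | cons f p ih => simp [Chain.append, degree, ih, add_assoc]

theorem length_append {x y z : P.Ob} (a : P.HChain x y) (b : P.HChain y z) :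
    (a.append b).length = a.length + b.length := by
  induction a with
  | nil x => simp [Chain.append, Chain.length]
  | cons f p ih => simp [Chain.append, Chain.length, ih]; omega

theorem hmap_eq (F : FormalMorphism P Q) {x y : P.Ob} (p : P.HChain x y) (d : ℤ)
    (h : degree p + 1 - p.length = d) : F.hmap p = ⟨d, F.map p, h ▸ F.map_mem p⟩ := by
  subst h
  rfl

theorem blocks_append (F : FormalMorphism P Q) {x y z : P.Ob} (a : Chain P.HChain x y)
    (b : Chain P.HChain y z) : F.blocks (a.append b) = (F.blocks a).append (F.blocks b) := by
  induction a with
  | nil x => rfl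
  | cons f p ih => exact congrArg (Chain.cons (F.hmap f)) (ih b)

theorem degree_blocks (F : FormalMorphism P Q) {x y : P.Ob} (p : P.HChain x y) :
    ∀ c ∈ p.cuts, degree (F.blocks c) - (F.blocks c).length = degree p - p.length := by
  induction p with
  | nil x =>
    intro c hc
    simp only [Chain.cuts, List.mem_singleton] at hc
    subst hc
    simp [blocks, Chain.map, degree, Chain.length]
  | cons f p ih =>
    intro c hc
    simp only [Chain.cuts, List.mem_flatMap, List.mem_cons] at hc
    obtain ⟨e, he, hc⟩ := hc
    have := ih e he
    rcases hc with rfl | hc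
    · simp only [blocks, Chain.map, degree, Chain.length, hmap, Chain.single] at this ⊢
      push_cast
      linarith
    · cases e with
      | nil => simp [Chain.growFirst] at hc
      | cons b e =>
        simp only [Chain.growFirst, List.mem_singleton] at hc
        subst hc
        simp only [blocks, Chain.map, degree, Chain.length, hmap] at this ⊢
        push_cast at this ⊢
        linarith

/-- Linearity of a function of strings of blocks in each entry of each block. -/
def IsBlockMultilinear {x w : P.Ob} {M : Type v} [AddCommGroup M] [Module R M]
    (Φ : Chain P.HChain x w → M) : Prop :=
  ∀ {x' w' y z : P.Ob} (A : Chain P.HChain x x') (C : Chain P.HChain w' w)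
    (a : P.HChain x' y) (n : ℤ) (r : R) (f g : P.gr y z n) (c : P.HChain z w'),
    Φ (A.append (.cons (a.append (.cons ⟨n, r • f + g⟩ c)) C)) =
      r • Φ (A.append (.cons (a.append (.cons ⟨n, f⟩ c)) C)) +
        Φ (A.append (.cons (a.append (.cons ⟨n, g⟩ c)) C))

theorem sum_cuts_cons {x y w : P.Ob} {M : Type v} [AddCommGroup M]
    (Φ : Chain P.HChain x w → M) (h : P.HomogHom x y) (p : P.HChain y w) :
    ((Chain.cuts (.cons h p)).map Φ).sum =
      (p.cuts.map fun e =>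
        Φ (.cons (.single h) e) + ((Chain.growFirst h e).map Φ).sum).sum := by
  simp only [Chain.cuts]
  induction p.cuts with
  | nil => simp
  | cons e l ih => simp only [List.flatMap_cons, List.map_append, List.sum_append, ih,
      List.map_cons, List.sum_cons]

theorem IsBlockMultilinear.sum_cuts {x w : P.Ob} {M : Type v} [AddCommGroup M] [Module R M]
    {Φ : Chain P.HChain x w → M} (hΦ : IsBlockMultilinear Φ) :
    IsMultilinear (fun p : P.HChain x w => (p.cuts.map Φ).sum) := by
  intro y z a
  induction a with
  | nil x =>
    intro n r f g c
    simp only [Chain.append, sum_cuts_cons]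
    induction c.cuts with
    | nil => simp
    | cons e l ih =>
      simp only [List.map_cons, List.sum_cons, ih, smul_add]
      have h1 := hΦ (.nil _) e (.nil _) n r f g (.nil _)
      simp only [Chain.append] at h1
      simp only [Chain.single, h1]
      cases e with
      | nil => simp only [Chain.growFirst, List.map_nil, List.sum_nil, smul_zero]; abel
      | cons b e =>
        have h2 := hΦ (.nil _) e (.nil _) n r f g b
        simp only [Chain.append] at h2
        simp only [Chain.growFirst, List.map_cons, List.map_nil, List.sum_cons, List.sum_nil, h2]
        simp only [add_zero]
        abel
  | cons h a ih =>
    intro n r f g c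
    simp only [Chain.append, sum_cuts_cons]
    refine ih (Φ := fun e => Φ (.cons (.single h) e) + ((Chain.growFirst h e).map Φ).sum)
      ?_ n r f g c
    intro x' w' y z A C a n r f g c
    have h1 := hΦ (.cons (.single h) A) C a n r f g c
    simp only [Chain.append] at h1
    simp only [h1, smul_add]
    cases A with
    | nil =>
      have h2 := hΦ (.nil _) C (.cons h a) n r f g c
      simp only [Chain.append] at h2
      simp only [Chain.append, Chain.growFirst, List.map_cons, List.map_nil, List.sum_cons,
        List.sum_nil, h2, add_zero]
      abel
    | cons b A =>
      have h2 := hΦ (.cons (.cons h b) A) C a n r f g c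
      simp only [Chain.append] at h2
      simp only [Chain.append, Chain.growFirst, List.map_cons, List.map_nil, List.sum_cons,
        List.sum_nil, h2, add_zero]
      abel

theorem isBlockMultilinear_map_blocks (G : FormalMorphism Q S) (F : FormalMorphism P Q)
    (x y : P.Ob) : IsBlockMultilinear (fun c : Chain P.HChain x y => G.map (F.blocks c)) := by
  intro x' w' y z A C a n r f g c
  have key : ∀ f : P.gr y z n,
      F.blocks (A.append (.cons (a.append (.cons ⟨n, f⟩ c)) C)) =
        (F.blocks A).append (.cons ⟨degree a + n + degree c + 1 - (a.length + c.length + 1),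
          F.map (a.append (.cons ⟨n, f⟩ c)), by
            have := F.map_mem (a.append (.cons ⟨n, f⟩ c))
            simpa [degree_append, length_append, degree, Chain.length, add_assoc] using this⟩
          (F.blocks C)) := by
    intro f
    rw [blocks_append]
    congr 1
    refine congrArg (fun t => Chain.cons t (F.blocks C)) (F.hmap_eq _ _ ?_)
    simp [degree_append, length_append, degree, Chain.length, add_assoc]
  simp only [key]
  rw [← G.map_multilinear]
  congr 4
  exact Subtype.ext (F.map_multilinear _ _ a n r f g c)

/-- Composition of formal morphisms:
`(G · F)ⁿ(fₙ, …, f₁) = ∑ Gʳ(F(fₙ, …), …, F(…, f₁))`, the sum over all ways to cut the string into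
consecutive nonempty blocks. -/
def comp (G : FormalMorphism Q S) (F : FormalMorphism P Q) : FormalMorphism P S where
  obj x := G.obj (F.obj x)
  map p := (p.cuts.map fun c => G.map (F.blocks c)).sum
  map_nil x := by
    simpa [Chain.cuts, blocks, Chain.map] using G.map_nil (F.obj x)
  map_mem p := by
    refine list_sum_mem ?_
    intro t ht
    obtain ⟨c, hc, rfl⟩ := List.mem_map.1 ht
    have h1 := F.degree_blocks p c hc
    have h2 := G.map_mem (F.blocks c)
    have h3 : degree (F.blocks c) + 1 - ((F.blocks c).length : ℤ) = degree p + 1 - p.length := by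
      linarith
    rwa [h3] at h2
  map_multilinear x y := IsBlockMultilinear.sum_cuts (isBlockMultilinear_map_blocks G F x y)

end FormalMorphism

/-! ### A-infinity categories and A-infinity functors -/

/-- A flat (not necessarily unital) `A∞`-category over `R`: multilinear operations `mⁿ` of degree
`2 - n`, with `m⁰ = 0`, such that for every string of homogeneous morphisms
`∑ (-1)^(deg f₁ + ⋯ + deg f_d - d) m(fₙ, …, m(f_{d+k}, …, f_{d+1}), f_d, …, f₁) = 0`.
Blocks of length `0` occur in the sum, but contribute `0` since `m⁰ = 0`. -/
structure AInfCategory (R : Type v) [CommRing R] extends GradedQuiver.{u, v} R where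
  /-- all the operations `mⁿ` -/
  m : ∀ {x y : Ob}, toGradedQuiver.HChain x y → Hom x y
  m_nil : ∀ x, m (.nil x) = 0
  m_mem : ∀ {x y : Ob} (p : toGradedQuiver.HChain x y), m p ∈ gr x y (degree p + 2 - p.length)
  m_multilinear : ∀ x y : Ob, IsMultilinear (fun p : toGradedQuiver.HChain x y => m p)
  m_rel : ∀ {x y : Ob} (p : toGradedQuiver.HChain x y),
    (p.splits₃.map fun s => (degree s.fst - s.fst.length).negOnePow •
      m (s.fst.append (.cons ⟨degree s.mid + 2 - s.mid.length, m s.mid, m_mem s.mid⟩ s.lst))).sum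
      = 0

/-- The value of the operations on a string, as a homogeneous morphism. -/
def AInfCategory.hm (A : AInfCategory.{u, v} R) {x y : A.Ob} (p : A.HChain x y) :
    A.HomogHom x y :=
  ⟨degree p + 2 - p.length, A.m p, A.m_mem p⟩

/-- A strictly unital flat `A∞`-category. -/
structure UnitalAInfCategory (R : Type v) [CommRing R] extends AInfCategory.{u, v} R where
  /-- the units -/
  one : ∀ x, gr x x 0
  /-- `m²(1, f) = (-1)^(deg f) f` -/
  m_one_left : ∀ {x y : Ob} (n : ℤ) (f : gr x y n),
    m (.cons ⟨n, f⟩ (.single ⟨0, one y⟩)) = n.negOnePow • (f : Hom x y)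
  /-- `m²(f, 1) = f` -/
  m_one_right : ∀ {x y : Ob} (n : ℤ) (f : gr x y n),
    m (.cons ⟨0, one x⟩ (.single ⟨n, f⟩)) = f
  /-- `mⁿ(…, 1, …) = 0` for `n ≠ 2` -/
  m_one : ∀ {x y z : Ob} (a : toGradedQuiver.HChain x y) (c : toGradedQuiver.HChain y z),
    a.length + 1 + c.length ≠ 2 → m (a.append (.cons ⟨0, one y⟩ c)) = 0

/-- An `A∞`-functor: a formal morphism `F` such that for every string of homogeneous morphisms
`∑ m(F(fₙ, …), …, F(…, f₁))` (the sum over all ways to cut the string into nonempty blocks) equals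
`∑ (-1)^(deg f₁ + ⋯ + deg f_d - d) F(fₙ, …, m(f_{d+k}, …, f_{d+1}), f_d, …, f₁)`. -/
structure AInfFunctor (A B : AInfCategory.{u, v} R) extends
    FormalMorphism A.toGradedQuiver B.toGradedQuiver where
  map_rel : ∀ {x y : A.Ob} (p : A.HChain x y),
    (p.cuts.map fun c => B.m (toFormalMorphism.blocks c)).sum =
      (p.splits₃.map fun s => (degree s.fst - s.fst.length).negOnePow •
        map (s.fst.append (.cons (A.hm s.mid) s.lst))).sum

/-- A strictly unital `A∞`-functor. -/
structure UnitalAInfFunctor (A B : UnitalAInfCategory.{u, v} R) extends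
    AInfFunctor A.toAInfCategory B.toAInfCategory where
  /-- `F¹(1) = 1` -/
  map_one_single : ∀ x : A.Ob, map (.single ⟨0, A.one x⟩) = (B.one (obj x) : B.Hom _ _)
  /-- `Fⁿ(…, 1, …) = 0` for `n ≥ 2` -/
  map_one : ∀ {x y z : A.Ob} (a : A.HChain x y) (c : A.HChain y z),
    2 ≤ a.length + 1 + c.length → map (a.append (.cons ⟨0, A.one y⟩ c)) = 0

/-! ### Pullbacks -/

/-- The square with `α : P → A''`, `β : P → A`, `F : A → A'`, `G : A'' → A'` is a pullback square
in the category of strictly unital (flat) `A∞`-categories and strictly unital `A∞`-functors. -/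
structure IsAInfPullback {P A A' A'' : UnitalAInfCategory.{u, v} R}
    (α : UnitalAInfFunctor P A'') (β : UnitalAInfFunctor P A)
    (F : UnitalAInfFunctor A A') (G : UnitalAInfFunctor A'' A') : Prop where
  comm : G.toFormalMorphism.comp α.toFormalMorphism = F.toFormalMorphism.comp β.toFormalMorphism
  existsUnique_lift : ∀ (C : UnitalAInfCategory.{u, v} R) (L : UnitalAInfFunctor C A'')
    (I : UnitalAInfFunctor C A),
    G.toFormalMorphism.comp L.toFormalMorphism = F.toFormalMorphism.comp I.toFormalMorphism →
    ∃! N : UnitalAInfFunctor C P,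
      α.toFormalMorphism.comp N.toFormalMorphism = L.toFormalMorphism ∧
      β.toFormalMorphism.comp N.toFormalMorphism = I.toFormalMorphism

/-! ### Cohomology -/

namespace GradedQuiver

theorem IsMultilinear.map_zero {Q : GradedQuiver.{u, v} R} {x w y z : Q.Ob} {M : Type v}
    [AddCommGroup M] [Module R M] {φ : Q.HChain x w → M} (h : IsMultilinear φ)
    (a : Q.HChain x y) (n : ℤ) (c : Q.HChain z w) : φ (a.append (.cons ⟨n, 0⟩ c)) = 0 := by
  have h0 := h a n 1 0 0 c
  simpa using h0

theorem homog_ext {Q : GradedQuiver.{u, v} R} {x y : Q.Ob} {q : Q.HomogHom x y} {k : ℤ}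
    {f : Q.gr x y k} (hd : q.1 = k) (hv : (q.2 : Q.Hom x y) = f) : q = ⟨k, f⟩ := by
  obtain ⟨n, g⟩ := q
  obtain rfl : n = k := hd
  obtain rfl : g = f := Subtype.ext hv
  rfl

end GradedQuiver

namespace AInfCategory

variable (A : AInfCategory.{u, v} R)

/-- The differential `m¹` on the part of degree `n`. -/
def d (x y : A.Ob) (n : ℤ) : A.gr x y n →ₗ[R] A.Hom x y where
  toFun f := A.m (.single ⟨n, f⟩)
  map_add' f g := by
    have h := A.m_multilinear x y (.nil x) n 1 f g (.nil y)
    simpa [Chain.append, Chain.single] using h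
  map_smul' r f := by
    have h0 := IsMultilinear.map_zero (A.m_multilinear x y) (.nil x) n (.nil y)
    have h := A.m_multilinear x y (.nil x) n r f 0 (.nil y)
    simp only [Chain.append, add_zero] at h0 h
    simpa [Chain.single, h0] using h

/-- The product `m²(g, f)` of morphisms of degree `0`. -/
def mul {x y z : A.Ob} (g : A.gr y z 0) (f : A.gr x y 0) : A.gr x z 0 :=
  ⟨A.m (.cons ⟨0, f⟩ (.single ⟨0, g⟩)), by
    have h := A.m_mem (Chain.cons (⟨0, f⟩ : A.HomogHom x y) (.single ⟨0, g⟩))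
    simpa [Chain.single, degree, Chain.length] using h⟩

/-- Cocycles of degree `n`. -/
def cocycles (x y : A.Ob) (n : ℤ) : Submodule R (A.gr x y n) := LinearMap.ker (A.d x y n)

/-- Coboundaries of degree `n`: the elements `m¹(h)` with `h` of degree `n - 1`. -/
def coboundaries (x y : A.Ob) (n : ℤ) : Submodule R (A.gr x y n) :=
  (LinearMap.range (A.d x y (n - 1))).comap (A.gr x y n).subtype

/-- The cohomology `Hⁿ(A)(x, y)`. -/
abbrev H (x y : A.Ob) (n : ℤ) : Type v :=
  A.cocycles x y n ⧸ (A.coboundaries x y n).comap (A.cocycles x y n).subtype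

variable {A}

theorem mem_cocycles {x y : A.Ob} {n : ℤ} {f : A.gr x y n} :
    f ∈ A.cocycles x y n ↔ A.m (.single ⟨n, f⟩) = 0 := Iff.rfl

theorem mem_coboundaries {x y : A.Ob} {n : ℤ} {f : A.gr x y n} :
    f ∈ A.coboundaries x y n ↔
      ∃ h : A.gr x y (n - 1), A.m (.single ⟨n - 1, h⟩) = f := Iff.rfl

theorem m_insert_zero {x y z w : A.Ob} (a : A.HChain x y) (q : A.HomogHom y z)
    (hq : (q.2 : A.Hom y z) = 0) (c : A.HChain z w) : A.m (a.append (.cons q c)) = 0 := by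
  obtain ⟨n, f⟩ := q
  obtain rfl : f = 0 := Subtype.ext hq
  exact IsMultilinear.map_zero (A.m_multilinear x w) a n c

theorem m_cons_zero {x y w : A.Ob} (q : A.HomogHom x y)
    (hq : (q.2 : A.Hom x y) = 0) (c : A.HChain y w) : A.m (.cons q c) = 0 :=
  m_insert_zero (.nil x) q hq c

theorem m_cons_cons_zero {x y z w : A.Ob} (f : A.HomogHom x y) (q : A.HomogHom y z)
    (hq : (q.2 : A.Hom y z) = 0) (c : A.HChain z w) : A.m (.cons f (.cons q c)) = 0 :=
  m_insert_zero (.single f) q hq c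

theorem m_cons_cons_cons_zero {x x' y z w : A.Ob} (f : A.HomogHom x x') (g : A.HomogHom x' y)
    (q : A.HomogHom y z) (hq : (q.2 : A.Hom y z) = 0) (c : A.HChain z w) :
    A.m (.cons f (.cons g (.cons q c))) = 0 :=
  m_insert_zero (.cons f (.single g)) q hq c

theorem m_rel_hm {x y : A.Ob} (p : A.HChain x y) :
    (p.splits₃.map fun s => (degree s.fst - s.fst.length).negOnePow •
      A.m (s.fst.append (.cons (A.hm s.mid) s.lst))).sum = 0 := A.m_rel p

theorem hm_nil (x : A.Ob) : ((A.hm (.nil x)).2 : A.Hom x x) = 0 := A.m_nil x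

theorem rel_two {x y z : A.Ob} {n k : ℤ} (f : A.gr x y n) (g : A.gr y z k) :
    A.m (.cons (A.hm (.single ⟨n, f⟩)) (.single ⟨k, g⟩)) +
      A.m (.single (A.hm (.cons ⟨n, f⟩ (.single ⟨k, g⟩)))) +
      (n - 1).negOnePow • A.m (.cons ⟨n, f⟩ (.single (A.hm (.single ⟨k, g⟩)))) = 0 := by
  have h := A.m_rel_hm (.cons ⟨n, f⟩ (.single ⟨k, g⟩))
  simpa [Chain.splits₃, Chain.splits, Chain.single, Chain.append, degree, Chain.length,
    m_cons_zero _ (hm_nil _), m_cons_cons_zero _ _ (hm_nil _),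
    m_cons_cons_cons_zero _ _ _ (hm_nil _), add_assoc] using h

theorem rel_three {x y z w : A.Ob} {n k l : ℤ} (f : A.gr x y n) (g : A.gr y z k) (h : A.gr z w l)
    (hf : f ∈ A.cocycles x y n) (hg : g ∈ A.cocycles y z k) (hh : h ∈ A.cocycles z w l) :
    A.m (.cons (A.hm (.cons ⟨n, f⟩ (.single ⟨k, g⟩))) (.single ⟨l, h⟩)) +
      A.m (.single (A.hm (.cons ⟨n, f⟩ (.cons ⟨k, g⟩ (.single ⟨l, h⟩))))) +
      (n - 1).negOnePow • A.m (.cons ⟨n, f⟩ (.single (A.hm (.cons ⟨k, g⟩ (.single ⟨l, h⟩))))) =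
      0 := by
  have hf' : ((A.hm (.cons ⟨n, f⟩ (.nil y))).2 : A.Hom x y) = 0 := hf
  have hg' : ((A.hm (.cons ⟨k, g⟩ (.nil z))).2 : A.Hom y z) = 0 := hg
  have hh' : ((A.hm (.cons ⟨l, h⟩ (.nil w))).2 : A.Hom z w) = 0 := hh
  have e : A.m (.cons ⟨n, f⟩ (.cons ⟨k, g⟩ (.cons ⟨l, h⟩ (.cons (A.hm (.nil w)) (.nil w))))) = 0 :=
    m_insert_zero (.cons ⟨n, f⟩ (.cons ⟨k, g⟩ (.single ⟨l, h⟩))) _ (hm_nil w) (.nil w)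
  have h := A.m_rel_hm (.cons ⟨n, f⟩ (.cons ⟨k, g⟩ (.single ⟨l, h⟩)))
  simpa [Chain.splits₃, Chain.splits, Chain.single, Chain.append, degree, Chain.length,
    m_cons_zero _ (hm_nil _), m_cons_cons_zero _ _ (hm_nil _),
    m_cons_cons_cons_zero _ _ _ (hm_nil _), m_cons_zero _ hf', m_cons_cons_zero _ _ hg',
    m_cons_cons_cons_zero _ _ _ hh', e, add_assoc] using h

theorem hm_single {x y : A.Ob} {n k : ℤ} {f : A.gr x y n} {g : A.gr x y k}
    (h : A.m (.single ⟨n, f⟩) = g) (e : n + 1 = k) : A.hm (.single ⟨n, f⟩) = ⟨k, g⟩ :=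
  homog_ext (by simp [hm, degree, Chain.single, Chain.length]; omega) h

theorem hm_pair {x y z : A.Ob} (g : A.gr y z 0) (f : A.gr x y 0) :
    A.hm (.cons ⟨0, f⟩ (.single ⟨0, g⟩)) = ⟨0, A.mul g f⟩ :=
  homog_ext (by simp [hm, degree, Chain.single, Chain.length]) rfl

theorem coboundary_of {x y : A.Ob} {n : ℤ} {f : A.gr x y n} (q : A.HomogHom x y)
    (hd : q.1 + 1 = n) (h : A.m (.single q) = f) : f ∈ A.coboundaries x y n := by
  obtain ⟨k, g⟩ := q
  obtain rfl : k = n - 1 := by simp only at hd; omega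
  exact mem_coboundaries.2 ⟨g, h⟩

/-- A product of cocycles is a cocycle. -/
theorem mul_mem_cocycles {x y z : A.Ob} {g : A.gr y z 0} {f : A.gr x y 0}
    (hg : g ∈ A.cocycles y z 0) (hf : f ∈ A.cocycles x y 0) :
    A.mul g f ∈ A.cocycles x z 0 := by
  have hg' : ((A.hm (.single ⟨0, g⟩)).2 : A.Hom y z) = 0 := hg
  have h := rel_two f g
  rw [m_cons_zero (A.hm (.single ⟨0, f⟩)) hf,
    show A.m (.cons ⟨0, f⟩ (.single (A.hm (.single ⟨0, g⟩)))) = 0 from m_cons_cons_zero _ _ hg' _,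
    hm_pair] at h
  exact mem_cocycles.2 (by simpa using h)

theorem mul_sub_left {x y z : A.Ob} (g g' : A.gr y z 0) (f : A.gr x y 0) :
    A.mul (g - g') f = A.mul g f - A.mul g' f := by
  have h := A.m_multilinear x z (.single ⟨0, f⟩) 0 (-1) g' g (.nil z)
  simp only [neg_smul, one_smul, neg_add_eq_sub] at h
  exact Subtype.ext h

theorem mul_sub_right {x y z : A.Ob} (g : A.gr y z 0) (f f' : A.gr x y 0) :
    A.mul g (f - f') = A.mul g f - A.mul g f' := by
  have h := A.m_multilinear x z (.nil x) 0 (-1) f' f (.single ⟨0, g⟩)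
  simp only [neg_smul, one_smul, neg_add_eq_sub] at h
  exact Subtype.ext h

theorem mul_mem_coboundaries_left {x y z : A.Ob} {g : A.gr y z 0} {f : A.gr x y 0}
    (hg : g ∈ A.coboundaries y z 0) (hf : f ∈ A.cocycles x y 0) :
    A.mul g f ∈ A.coboundaries x z 0 := by
  obtain ⟨b, hb⟩ := mem_coboundaries.1 hg
  have h := rel_two f b
  rw [m_cons_zero (A.hm (.single ⟨0, f⟩)) hf, zero_add, hm_single hb (by omega)] at h
  simp only [zero_sub, Int.negOnePow_neg, Int.negOnePow_one, Units.neg_smul, one_smul] at h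
  refine coboundary_of _ ?_ (add_neg_eq_zero.1 h)
  simp [hm, degree, Chain.single, Chain.length]

theorem mul_mem_coboundaries_right {x y z : A.Ob} {g : A.gr y z 0} {f : A.gr x y 0}
    (hg : g ∈ A.cocycles y z 0) (hf : f ∈ A.coboundaries x y 0) :
    A.mul g f ∈ A.coboundaries x z 0 := by
  obtain ⟨b, hb⟩ := mem_coboundaries.1 hf
  have hg' : ((A.hm (.single ⟨0, g⟩)).2 : A.Hom y z) = 0 := hg
  have h := rel_two b g
  rw [show A.m (.cons ⟨0 - 1, b⟩ (.single (A.hm (.single ⟨0, g⟩)))) = 0 from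
    m_cons_cons_zero _ _ hg' _, smul_zero, add_zero, hm_single hb (by omega)] at h
  rw [← neg_mem_iff]
  refine coboundary_of _ ?_ (eq_neg_of_add_eq_zero_right h)
  simp [hm, degree, Chain.single, Chain.length]

theorem mul_assoc_mem_coboundaries {x y z w : A.Ob} {h : A.gr z w 0} {g : A.gr y z 0}
    {f : A.gr x y 0} (hh : h ∈ A.cocycles z w 0) (hg : g ∈ A.cocycles y z 0)
    (hf : f ∈ A.cocycles x y 0) :
    A.mul (A.mul h g) f - A.mul h (A.mul g f) ∈ A.coboundaries x w 0 := by
  have e := rel_three f g h hf hg hh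
  rw [hm_pair, hm_pair] at e
  refine coboundary_of (A.hm (.cons ⟨0, f⟩ (.cons ⟨0, g⟩ (.single ⟨0, h⟩)))) ?_ ?_
  · simp [hm, degree, Chain.single, Chain.length]
  · simp only [zero_sub, Int.negOnePow_neg, Int.negOnePow_one, Units.neg_smul, one_smul] at e
    rw [add_neg_eq_zero, add_comm] at e
    exact eq_sub_of_add_eq e

/-- The composition of classes of degree `0`, induced by `m²`. -/
def H.comp {x y z : A.Ob} (g : A.H y z 0) (f : A.H x y 0) : A.H x z 0 :=
  Quotient.map₂
    (fun g f => ⟨A.mul g.1 f.1, mul_mem_cocycles g.2 f.2⟩)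
    (by
      intro g g' hg f f' hf
      have hg := (Submodule.quotientRel_def _).1 hg
      have hf := (Submodule.quotientRel_def _).1 hf
      refine (Submodule.quotientRel_def _).2 ?_
      have h1 := mul_mem_coboundaries_left (A := A) hg f.2
      have h2 := mul_mem_coboundaries_right (A := A) g'.2 hf
      have h3 := add_mem h1 h2
      simp only [map_sub, Submodule.subtype_apply, mul_sub_left, mul_sub_right,
        sub_add_sub_cancel] at h3
      simpa using h3) g f

/-- The class of a cocycle. -/
def cls {x y : A.Ob} {n : ℤ} (f : A.gr x y n) (hf : f ∈ A.cocycles x y n) : A.H x y n :=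
  Submodule.Quotient.mk ⟨f, hf⟩

theorem cls_eq {x y : A.Ob} {n : ℤ} {f g : A.gr x y n} {hf : f ∈ A.cocycles x y n}
    {hg : g ∈ A.cocycles x y n} : cls f hf = cls g hg ↔ f - g ∈ A.coboundaries x y n :=
  Submodule.Quotient.eq _

theorem exists_cls {x y : A.Ob} {n : ℤ} (a : A.H x y n) : ∃ f hf, a = cls f hf := by
  obtain ⟨⟨f, hf⟩, rfl⟩ := Submodule.Quotient.mk_surjective _ a
  exact ⟨f, hf, rfl⟩

theorem comp_cls {x y z : A.Ob} {g : A.gr y z 0} {f : A.gr x y 0}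
    (hg : g ∈ A.cocycles y z 0) (hf : f ∈ A.cocycles x y 0) :
    H.comp (cls g hg) (cls f hf) = cls (A.mul g f) (mul_mem_cocycles hg hf) := rfl

end AInfCategory

namespace UnitalAInfCategory

variable (A : UnitalAInfCategory.{u, v} R)

theorem one_mem_cocycles (x : A.Ob) : A.one x ∈ A.cocycles x x 0 :=
  A.m_one (.nil x) (.nil x) (by simp [Chain.length])

/-- The category `H⁰(A)`: the objects are those of `A`. -/
structure H0 where
  /-- the object of `A` -/
  ob : A.Ob

instance : Category (H0 A) where
  Hom x y := A.H x.ob y.ob 0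
  id x := AInfCategory.cls (A.one x.ob) (A.one_mem_cocycles x.ob)
  comp f g := AInfCategory.H.comp g f
  id_comp f := by
    obtain ⟨f, hf, rfl⟩ := AInfCategory.exists_cls f
    rw [AInfCategory.comp_cls]
    congr 1
    exact Subtype.ext (A.m_one_right 0 f)
  comp_id f := by
    obtain ⟨f, hf, rfl⟩ := AInfCategory.exists_cls f
    rw [AInfCategory.comp_cls]
    congr 1
    exact Subtype.ext ((A.m_one_left 0 f).trans (by simp))
  assoc f g h := by
    obtain ⟨f, hf, rfl⟩ := AInfCategory.exists_cls f
    obtain ⟨g, hg, rfl⟩ := AInfCategory.exists_cls g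
    obtain ⟨h, hh, rfl⟩ := AInfCategory.exists_cls h
    simp only [AInfCategory.comp_cls]
    exact (AInfCategory.cls_eq.2 (AInfCategory.mul_assoc_mem_coboundaries hh hg hf)).symm

end UnitalAInfCategory

namespace AInfFunctor

variable {A B : AInfCategory.{u, v} R} (F : AInfFunctor A B)

theorem map_insert_zero {x y z w : A.Ob} (a : A.HChain x y) (q : A.HomogHom y z)
    (hq : (q.2 : A.Hom y z) = 0) (c : A.HChain z w) : F.map (a.append (.cons q c)) = 0 := by
  obtain ⟨n, f⟩ := q
  obtain rfl : f = 0 := Subtype.ext hq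
  exact IsMultilinear.map_zero (F.map_multilinear x w) a n c

theorem map_cons_zero {x y w : A.Ob} (q : A.HomogHom x y)
    (hq : (q.2 : A.Hom x y) = 0) (c : A.HChain y w) : F.map (.cons q c) = 0 :=
  F.map_insert_zero (.nil x) q hq c

theorem map_cons_cons_zero {x y z w : A.Ob} (f : A.HomogHom x y) (q : A.HomogHom y z)
    (hq : (q.2 : A.Hom y z) = 0) (c : A.HChain z w) : F.map (.cons f (.cons q c)) = 0 :=
  F.map_insert_zero (.single f) q hq c

theorem map_cons_cons_cons_zero {x x' y z w : A.Ob} (f : A.HomogHom x x') (g : A.HomogHom x' y)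
    (q : A.HomogHom y z) (hq : (q.2 : A.Hom y z) = 0) (c : A.HChain z w) :
    F.map (.cons f (.cons g (.cons q c))) = 0 :=
  F.map_insert_zero (.cons f (.single g)) q hq c

theorem hmap_single {x y : A.Ob} {n : ℤ} (f : A.gr x y n) :
    F.hmap (.single ⟨n, f⟩) = ⟨n, F.lin x y n f⟩ :=
  homog_ext (by simp [FormalMorphism.hmap, degree, Chain.single, Chain.length]) rfl

theorem map_rel_one {x y : A.Ob} {n : ℤ} (f : A.gr x y n) :
    B.m (.single ⟨n, F.lin x y n f⟩) = F.map (.single (A.hm (.single ⟨n, f⟩))) := by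
  have h := F.map_rel (.single ⟨n, f⟩)
  have e := F.hmap_single f
  simp only [Chain.single] at e
  simpa [Chain.splits₃, Chain.splits, Chain.cuts, Chain.growFirst, FormalMorphism.blocks,
    Chain.map, e, Chain.single, Chain.append, degree, Chain.length,
    F.map_cons_zero _ (AInfCategory.hm_nil _),
    F.map_cons_cons_zero _ _ (AInfCategory.hm_nil _)] using h

theorem map_rel_two {x y z : A.Ob} {f : A.gr x y 0} {g : A.gr y z 0}
    (hf : f ∈ A.cocycles x y 0) (hg : g ∈ A.cocycles y z 0) :
    B.m (.cons ⟨0, F.lin x y 0 f⟩ (.single ⟨0, F.lin y z 0 g⟩)) +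
      B.m (.single (F.hmap (.cons ⟨0, f⟩ (.single ⟨0, g⟩)))) =
      F.map (.single ⟨0, A.mul g f⟩) := by
  have h := F.map_rel (.cons ⟨0, f⟩ (.single ⟨0, g⟩))
  have e1 := F.hmap_single f
  have e2 := F.hmap_single g
  have e3 := AInfCategory.hm_pair g f
  have hf' : ((A.hm (.cons ⟨0, f⟩ (.nil y))).2 : A.Hom x y) = 0 := hf
  have hg' : ((A.hm (.cons ⟨0, g⟩ (.nil z))).2 : A.Hom y z) = 0 := hg
  simp only [Chain.single] at e1 e2 e3
  simpa [Chain.splits₃, Chain.splits, Chain.cuts, Chain.growFirst, FormalMorphism.blocks,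
    Chain.map, e1, e2, e3, Chain.single, Chain.append, degree, Chain.length,
    F.map_cons_zero _ (AInfCategory.hm_nil _), F.map_cons_cons_zero _ _ (AInfCategory.hm_nil _),
    F.map_cons_cons_cons_zero _ _ _ (AInfCategory.hm_nil _), F.map_cons_zero _ hf',
    F.map_cons_cons_zero _ _ hg'] using h

theorem lin_mem_cocycles {x y : A.Ob} {n : ℤ} {f : A.gr x y n} (hf : f ∈ A.cocycles x y n) :
    F.lin x y n f ∈ B.cocycles (F.obj x) (F.obj y) n :=
  (F.map_rel_one f).trans (F.map_cons_zero (A.hm (.single ⟨n, f⟩)) hf _)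

theorem lin_mem_coboundaries {x y : A.Ob} {n : ℤ} {f : A.gr x y n}
    (hf : f ∈ A.coboundaries x y n) :
    F.lin x y n f ∈ B.coboundaries (F.obj x) (F.obj y) n := by
  obtain ⟨b, hb⟩ := AInfCategory.mem_coboundaries.1 hf
  refine AInfCategory.coboundary_of ⟨n - 1, F.lin x y (n - 1) b⟩ (by simp) ?_
  rw [F.map_rel_one b, AInfCategory.hm_single hb (by omega)]
  rfl

/-- The map `Hⁿ(A)(x, y) → Hⁿ(B)(F x, F y)` induced by `F¹`. -/
def Hmap (x y : A.Ob) (n : ℤ) : A.H x y n →ₗ[R] B.H (F.obj x) (F.obj y) n :=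
  Submodule.mapQ _ _
    ((F.lin x y n).restrict fun _ hf => F.lin_mem_cocycles hf)
    fun _ hf => F.lin_mem_coboundaries hf

theorem Hmap_cls {x y : A.Ob} {n : ℤ} {f : A.gr x y n} (hf : f ∈ A.cocycles x y n) :
    F.Hmap x y n (AInfCategory.cls f hf) =
      AInfCategory.cls (F.lin x y n f) (F.lin_mem_cocycles hf) := rfl

end AInfFunctor

namespace UnitalAInfFunctor

variable {A B : UnitalAInfCategory.{u, v} R} (F : UnitalAInfFunctor A B)

/-- The functor `[F] : H⁰(A) ⥤ H⁰(B)` induced by `F`. -/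
def H0map : A.H0 ⥤ B.H0 where
  obj x := ⟨F.obj x.ob⟩
  map {x y} f := F.Hmap x.ob y.ob 0 f
  map_id x := by
    refine (F.Hmap_cls (A.one_mem_cocycles x.ob)).trans ?_
    congr 1
    exact Subtype.ext (F.map_one_single x.ob)
  map_comp {x y z} f g := by
    obtain ⟨f, hf, rfl⟩ := AInfCategory.exists_cls f
    obtain ⟨g, hg, rfl⟩ := AInfCategory.exists_cls g
    refine AInfCategory.cls_eq.2 (AInfCategory.coboundary_of
      (F.hmap (.cons ⟨0, f⟩ (.single ⟨0, g⟩))) ?_ ?_)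
    · simp [FormalMorphism.hmap, degree, Chain.single, Chain.length]
    · exact eq_sub_of_add_eq' (F.map_rel_two hf hg)

/-! ### Fibrations and quasi-equivalences -/

/-- Condition (F1): for all objects `x`, `y` the linear part
`F¹ : A(x, y) → B(F x, F y)` is a split surjection of graded modules, i.e. it has an `R`-linear
section that preserves degrees. -/
def IsSplitSurjective : Prop :=
  ∀ x y : A.Ob, ∃ s : ∀ n : ℤ, B.gr (F.obj x) (F.obj y) n →ₗ[R] A.gr x y n,
    ∀ n : ℤ, F.lin x y n ∘ₗ s n = LinearMap.id

/-- Condition (F2): `[F] : H⁰(A) ⥤ H⁰(B)` is an isofibration. -/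
def IsH0Isofibration : Prop := IsIsofibration F.H0map

/-- `F` is a quasi-equivalence: `[F] : H(A) ⥤ H(B)` is an equivalence of graded categories, i.e.
it is bijective on morphisms of every degree, and every object of `B` is isomorphic in `H⁰(B)`
to an object in the image of `F`. -/
def IsQuasiEquivalence : Prop :=
  (∀ (x y : A.Ob) (n : ℤ), Function.Bijective (F.Hmap x y n)) ∧ F.H0map.EssSurj

end UnitalAInfFunctor

end AInfinity

/-!
# Base change of fibrations of `A∞`-categories

The pullback `P` is only given by its universal property, and no model of it is constructed.
The universal property is tested on one family of small `A∞`-categories: `interval R n` has two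
objects and, besides the units, a free morphism of degree `n` between them together with its
differential. Of two consecutive morphisms of `interval R n`, one is zero or a multiple of a unit,
so strict unitality kills all higher components of a functor out of it; such a functor is the same
as a morphism of degree `n` of the target (`IntervalCat.functor`, `IntervalCat.IsTest.eq_functor`).
Hence the objects of `P` are the pairs of objects of `A` and `A''` with the same image in `A'`
(`IsAInfPullback.obj_ext`, `IsAInfPullback.exists_obj`), and `α¹`, `β¹` identify the complex
`P(p, q)` with the fiber product of complexes `A(βp, βq) ×_{A'} A''(αp, αq)`
(`IsAInfPullback.lin_ext`, `IsAInfPullback.exists_lin`).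

If `F` is a quasi-equivalence, then `α¹` is a base change of a surjective quasi-isomorphism, hence a
quasi-isomorphism, and essential surjectivity of `α` follows from the isofibration property of `F`.

For the isofibration property of `α`, lift an isomorphism `φ` of `H⁰(A'')` and its inverse to
`H⁰(A)` by (F2), correct the lifts by coboundaries so that they agree with `φ` and its inverse in
`A'`, and glue. This gives cocycles `f` and `g` of `P` such that `α` and `β` map the classes of `gf`
and `fg` to identities. Such classes are invertible, because degree-`0` classes killed by both `α`
and `β` multiply to zero (`IsAInfPullback.mul_mem_coboundaries`): the primitive of the product is
glued from primitives in `A` and `A''`, where the components `F²`, `α²` and `β²` account for the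
failure of the linear parts to be multiplicative.
-/

namespace AInfinity

variable {R : Type v} [CommRing R]

open GradedQuiver

/-! ### Lengths of blocks -/

namespace Chain

variable {V : Type*} {H : V → V → Type*}

theorem length_of_mem_splits {x z : V} (p : Chain H x z) :
    ∀ s ∈ p.splits, s.2.1.length + s.2.2.length = p.length := by
  induction p with
  | nil x => simp [splits, length]
  | cons f p ih =>
    intro s hs
    simp only [splits, List.mem_cons, List.mem_map] at hs
    rcases hs with rfl | ⟨t, ht, rfl⟩
    · simp [length]
    · have := ih t ht
      simp only [length]
      omega

theorem length_of_mem_splits₃ {x z : V} (p : Chain H x z) :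
    ∀ s ∈ p.splits₃, s.fst.length + s.mid.length + s.lst.length = p.length := by
  intro s hs
  simp only [splits₃, List.mem_flatMap, List.mem_map] at hs
  obtain ⟨a, ha, b, hb, rfl⟩ := hs
  have h1 := length_of_mem_splits p a ha
  have h2 := length_of_mem_splits _ b hb
  simp only
  omega

theorem length_pos_of_mem_cuts {x y z : V} (p : Chain H x z) (b : Chain H x y)
    (c : Chain (Chain H) y z) (h : cons b c ∈ p.cuts) : 0 < b.length := by
  cases p with
  | nil => simp [cuts] at h
  | cons f p =>
    simp only [cuts, List.mem_flatMap, List.mem_cons] at h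
    obtain ⟨e, -, h | h⟩ := h
    · cases h
      simp [single, length]
    · cases e with
      | nil => simp [growFirst] at h
      | cons b' e =>
        simp only [growFirst, List.mem_singleton] at h
        cases h
        simp [length]

end Chain

/-! ### Differential graded categories as `A∞`-categories -/

/-- A differential graded category over `R`: differentials of degree `1`, compositions of degree
`0` (written in the order of the arrows of a string), and units.  The Leibniz rule carries the
sign that makes `m¹ = d` and `m²(g, f) = (-1)^(deg f) g ∘ f` an `A∞`-structure. -/
structure DGCategory (R : Type v) [CommRing R] extends GradedQuiver.{u, v} R where
  /-- the differential -/
  d : ∀ {x y : Ob}, Hom x y →ₗ[R] Hom x y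
  /-- `comp f g` is the composite of first `f` and then `g` -/
  comp : ∀ {x y z : Ob}, Hom x y →ₗ[R] Hom y z →ₗ[R] Hom x z
  /-- the units -/
  one : ∀ x, gr x x 0
  d_mem : ∀ {x y : Ob} {n : ℤ} {f : Hom x y}, f ∈ gr x y n → d f ∈ gr x y (n + 1)
  comp_mem : ∀ {x y z : Ob} {n k : ℤ} {f : Hom x y} {g : Hom y z},
    f ∈ gr x y n → g ∈ gr y z k → comp f g ∈ gr x z (n + k)
  d_d : ∀ {x y : Ob} (f : Hom x y), d (d f) = 0
  d_comp : ∀ {x y z : Ob} {n : ℤ} {f : Hom x y} (g : Hom y z), f ∈ gr x y n →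
    d (comp f g) = comp (d f) g + n.negOnePow • comp f (d g)
  comp_assoc : ∀ {x y z w : Ob} (f : Hom x y) (g : Hom y z) (h : Hom z w),
    comp (comp f g) h = comp f (comp g h)
  d_one : ∀ x, d (one x : Hom x x) = 0
  one_comp : ∀ {x y : Ob} (f : Hom x y), comp (one x : Hom x x) f = f
  comp_one : ∀ {x y : Ob} (f : Hom x y), comp f (one y : Hom y y) = f

namespace DGCategory

variable (D : DGCategory.{u, v} R)

/-- The operations `m¹ = d` and `m²(g, f) = (-1)^(deg f) g ∘ f`, and `mⁿ = 0` for `n ≥ 3`. -/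
def op : {x y : D.Ob} → D.HChain x y → D.Hom x y
  | _, _, .nil _ => 0
  | _, _, .cons f (.nil _) => D.d f.2.1
  | _, _, .cons f (.cons g (.nil _)) => f.1.negOnePow • D.comp f.2.1 g.2.1
  | _, _, .cons _ (.cons _ (.cons _ _)) => 0

theorem op_eq_zero {x y : D.Ob} : (p : D.HChain x y) → 3 ≤ p.length → D.op p = 0
  | .nil _, h => by simp [Chain.length] at h
  | .cons f (.nil _), h => by simp [Chain.length] at h
  | .cons f (.cons g (.nil _)), h => by simp [Chain.length] at h
  | .cons _ (.cons _ (.cons _ _)), _ => by simp [op]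

theorem op_mem {x y : D.Ob} : (p : D.HChain x y) →
    D.op p ∈ D.gr x y (degree p + 2 - p.length)
  | .nil _ => by simp [op]
  | .cons f (.nil _) => by
    have := D.d_mem f.2.2
    have e : degree (Chain.cons f (.nil y)) + 2 - (Chain.cons f (.nil y)).length = f.1 + 1 := by
      simp [degree, Chain.length]; ring
    rw [e]
    exact this
  | .cons f (.cons g (.nil _)) => by
    have := (D.gr x y (f.1 + g.1)).smul_of_tower_mem f.1.negOnePow (D.comp_mem f.2.2 g.2.2)
    have e : degree (Chain.cons f (.cons g (.nil y))) + 2 -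
        (Chain.cons f (.cons g (.nil y))).length = f.1 + g.1 := by
      simp [degree, Chain.length]
    rw [e]
    exact this
  | .cons _ (.cons _ (.cons _ _)) => by simp [op]

theorem op_multilinear (x y : D.Ob) : IsMultilinear (fun p : D.HChain x y => D.op p) := by
  intro y z a n r f g c
  rcases a with _ | ⟨h, _ | ⟨h', _ | ⟨h'', a⟩⟩⟩ <;> rcases c with _ | ⟨k, _ | ⟨k', c⟩⟩ <;>
    simp [Chain.append, op, smul_comm r]

theorem op_insert_zero {x y z w : D.Ob} (a : D.HChain x y) (q : D.HomogHom y z)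
    (hq : (q.2 : D.Hom y z) = 0) (c : D.HChain z w) : D.op (a.append (.cons q c)) = 0 := by
  obtain ⟨n, f⟩ := q
  obtain rfl : f = 0 := Subtype.ext hq
  exact IsMultilinear.map_zero (D.op_multilinear x w) a n c

theorem op_rel {x y : D.Ob} (p : D.HChain x y) :
    (p.splits₃.map fun s => (degree s.fst - s.fst.length).negOnePow •
      D.op (s.fst.append (.cons ⟨degree s.mid + 2 - s.mid.length, D.op s.mid, D.op_mem s.mid⟩
        s.lst))).sum = 0 := by
  match p with
  | .nil _ => simp [Chain.splits₃, Chain.splits, Chain.append, op]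
  | .cons f (.nil _) => simp [Chain.splits₃, Chain.splits, Chain.append, op, D.d_d]
  | .cons f (.cons g (.nil _)) =>
    simp [Chain.splits₃, Chain.splits, Chain.append, op, degree, Chain.length,
      D.d_comp _ f.2.2, Int.negOnePow_add, Int.negOnePow_sub, smul_smul,
      Int.negOnePow_even 2 even_two]
  | .cons f (.cons g (.cons h (.nil _))) =>
    simp [Chain.splits₃, Chain.splits, Chain.append, op, degree, Chain.length,
      D.comp_assoc, Int.negOnePow_add, Int.negOnePow_sub, smul_smul]
    rw [mul_comm (_ * _) f.1.negOnePow, add_neg_cancel]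
  | .cons f (.cons g (.cons h (.cons k p))) =>
    -- a block has length at least `3`, or at least `3` arrows remain after it is evaluated
    refine List.sum_eq_zero ?_
    intro t ht
    obtain ⟨s, hs, rfl⟩ := List.mem_map.1 ht
    have hl := Chain.length_of_mem_splits₃ _ s hs
    simp only [Chain.length] at hl
    by_cases hm : 3 ≤ s.mid.length
    · rw [op_insert_zero _ _ _ (D.op_eq_zero _ hm), smul_zero]
    · rw [op_eq_zero, smul_zero]
      simp only [FormalMorphism.length_append, Chain.length]
      omega

/-- A differential graded category as an `A∞`-category. -/
abbrev toAInf : UnitalAInfCategory.{u, v} R where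
  toGradedQuiver := D.toGradedQuiver
  m := D.op
  m_nil x := by simp [op]
  m_mem := D.op_mem
  m_multilinear := D.op_multilinear
  m_rel := D.op_rel
  one := D.one
  m_one_left n f := by simp [op, Chain.single, D.comp_one]
  m_one_right n f := by simp [op, Chain.single, D.one_comp]
  m_one a c h := by
    by_cases h3 : 3 ≤ a.length + 1 + c.length
    · refine D.op_eq_zero _ ?_
      simp only [FormalMorphism.length_append, Chain.length]
      omega
    · rcases a with _ | ⟨f, a⟩
      · rcases c with _ | ⟨g, c⟩
        · simp [Chain.append, op, D.d_one]
        · simp only [Chain.length] at h h3; omega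
      · simp only [Chain.length] at h h3; omega

end DGCategory

/-! ### The test category -/

/-- The grading of `ι → R` in which the `i`-th basis vector has degree `deg i`. -/
def gradedPi (R : Type v) [CommRing R] {ι : Type} (deg : ι → ℤ) (k : ℤ) : Submodule R (ι → R) where
  carrier := {f | ∀ i, deg i ≠ k → f i = 0}
  add_mem' hf hg i hi := by simp [hf i hi, hg i hi]
  zero_mem' i _ := rfl
  smul_mem' r f hf i hi := by simp [hf i hi]

theorem gradedPi_isInternal {ι : Type} [Fintype ι] [DecidableEq ι] (deg : ι → ℤ) :
    DirectSum.IsInternal (gradedPi R deg) := by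
  -- the `i`-th coordinate of a sum of homogeneous elements only sees the part of degree `deg i`
  have key : ∀ i : ι, LinearMap.proj i ∘ₗ DirectSum.coeLinearMap (gradedPi R deg) =
      LinearMap.proj i ∘ₗ (gradedPi R deg (deg i)).subtype ∘ₗ
        DirectSum.component R ℤ (fun k => gradedPi R deg k) (deg i) := by
    intro i
    refine DirectSum.linearMap_ext R fun k => LinearMap.ext fun f => ?_
    by_cases h : deg i = k
    · subst h
      simp [DirectSum.component.lof_self]
    · have := f.2 i h
      simp [DirectSum.component.of, this, Ne.symm h]
  constructor
  · rw [injective_iff_map_eq_zero]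
    intro a ha
    refine DFinsupp.ext fun k => Subtype.ext (funext fun i => ?_)
    by_cases h : deg i = k
    · subst h
      have h1 := LinearMap.congr_fun (key i) a
      have h2 : DirectSum.coeLinearMap (gradedPi R deg) a = 0 := ha
      simp only [LinearMap.comp_apply, h2, map_zero] at h1
      exact h1.symm
    · exact (a k).2 i h
  · intro f
    refine ⟨∑ i, DirectSum.of (fun k => gradedPi R deg k) (deg i)
      ⟨Pi.single i (f i), fun j hj => ?_⟩, ?_⟩
    · refine Pi.single_eq_of_ne ?_ _
      rintro rfl
      exact hj rfl
    · simp [Finset.univ_sum_single]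

/-- The two objects of the test category. -/
inductive Pt : Type u
  | src
  | tgt

namespace IntervalCat

/-- The basis of the morphisms of the test category: the units, and a morphism from `src` to `tgt`
(`false`) together with its differential (`true`). -/
def Gen : Pt.{u} → Pt.{u} → Type
  | .src, .src => Unit
  | .src, .tgt => Bool
  | .tgt, .src => Empty
  | .tgt, .tgt => Unit

instance : ∀ s t : Pt.{u}, Fintype (Gen s t)
  | .src, .src => inferInstanceAs (Fintype Unit)
  | .src, .tgt => inferInstanceAs (Fintype Bool)
  | .tgt, .src => inferInstanceAs (Fintype Empty)
  | .tgt, .tgt => inferInstanceAs (Fintype Unit)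

instance : ∀ s t : Pt.{u}, DecidableEq (Gen s t)
  | .src, .src => inferInstanceAs (DecidableEq Unit)
  | .src, .tgt => inferInstanceAs (DecidableEq Bool)
  | .tgt, .src => inferInstanceAs (DecidableEq Empty)
  | .tgt, .tgt => inferInstanceAs (DecidableEq Unit)

/-- The degrees of the basis elements. -/
def deg (n : ℤ) : (s t : Pt.{u}) → Gen s t → ℤ
  | .src, .src, _ => 0
  | .src, .tgt, false => n
  | .src, .tgt, true => n + 1
  | .tgt, .tgt, _ => 0

/-- The differential of the test category: it sends the generator to the second basis element of
the morphisms from `src` to `tgt`. -/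
def diff : (s t : Pt.{u}) → (Gen s t → R) →ₗ[R] (Gen s t → R)
  | .src, .src => 0
  | .src, .tgt =>
    { toFun f i := Bool.rec 0 (f false) i
      map_add' f g := by
        ext (_ | _)
        · exact (add_zero 0).symm
        · rfl
      map_smul' r f := by
        ext (_ | _)
        · exact (mul_zero r).symm
        · rfl }
  | .tgt, .src => 0
  | .tgt, .tgt => 0

/-- The composition of the test category, in which every nonzero composite involves a multiple of
a unit. -/
def comp : (s t w : Pt.{u}) → (Gen s t → R) →ₗ[R] (Gen t w → R) →ₗ[R] (Gen s w → R)
  | .src, .src, _ => (LinearMap.lsmul R _).comp (LinearMap.proj ())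
  | .tgt, .tgt, _ => (LinearMap.lsmul R _).comp (LinearMap.proj ())
  | .src, .tgt, .tgt => ((LinearMap.lsmul R _).comp (LinearMap.proj ())).flip
  | .src, .tgt, .src => 0
  | .tgt, .src, _ => 0

theorem comp_src {w : Pt.{u}} (f : Gen Pt.src.{u} .src → R) (g : Gen .src w → R) :
    comp .src .src w f g = f () • g := rfl

theorem comp_tgt {w : Pt.{u}} (f : Gen Pt.tgt.{u} .tgt → R) (g : Gen .tgt w → R) :
    comp .tgt .tgt w f g = f () • g := rfl

theorem comp_src_tgt (f : Gen Pt.src.{u} .tgt → R) (g : Gen Pt.tgt.{u} .tgt → R) :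
    comp .src .tgt .tgt f g = g () • f := rfl

theorem comp_src_tgt_src (f : Gen Pt.src.{u} .tgt → R) (g : Gen Pt.tgt.{u} .src → R) :
    comp .src .tgt .src f g = 0 := rfl

theorem comp_tgt_src {w : Pt.{u}} (f : Gen Pt.tgt.{u} .src → R) (g : Gen .src w → R) :
    comp .tgt .src w f g = 0 := rfl

theorem diff_src : diff (R := R) Pt.src.{u} .src = 0 := rfl

theorem diff_tgt {w : Pt.{u}} : diff (R := R) Pt.tgt.{u} w = 0 := by cases w <;> rfl

theorem tgt_src_eq_zero (f : Gen Pt.tgt.{u} .src → R) : f = 0 := funext fun i => i.elim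

end IntervalCat

open IntervalCat in
/-- The differential graded category with two objects that is freely generated by a morphism of
degree `n` from `src` to `tgt` and its differential. -/
abbrev intervalDG (R : Type v) [CommRing R] (n : ℤ) : DGCategory.{u, v} R where
  Ob := Pt
  Hom s t := Gen s t → R
  gr s t := gradedPi R (deg n s t)
  isInternal s t := gradedPi_isInternal _
  d {s t} := diff s t
  comp {s t w} := comp s t w
  one
    | .src => ⟨fun _ => 1, fun _ h => absurd rfl h⟩
    | .tgt => ⟨fun _ => 1, fun _ h => absurd rfl h⟩
  d_mem {s t k f} hf := by
    rcases s with _ | _ <;> rcases t with _ | _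
    · exact zero_mem _
    · rintro (_ | _) h
      · rfl
      · exact hf false fun e => h (congrArg (· + 1) e)
    · exact zero_mem _
    · exact zero_mem _
  comp_mem {s t w k l f g} hf hg := by
    -- one factor is a multiple `r` of a unit, so that `r = 0` unless its degree `k` is `0`
    have key : ∀ {s' t' : Pt} (r : R) (k l : ℤ) (f : Gen s' t' → R),
        (0 ≠ k → r = 0) → f ∈ gradedPi R (deg n s' t') l →
        r • f ∈ gradedPi R (deg n s' t') (k + l) := by
      intro s' t' r k l f hr hf
      by_cases hk : 0 = k
      · subst hk
        rw [zero_add]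
        exact Submodule.smul_mem _ _ hf
      · rw [hr hk, zero_smul]
        exact zero_mem _
    rcases s with _ | _ <;> rcases t with _ | _
    · exact key (f ()) k l g (hf ()) hg
    · rcases w with _ | _
      · exact zero_mem _
      · rw [add_comm]
        exact key (g ()) l k f (hg ()) hf
    · exact zero_mem _
    · exact key (f ()) k l g (hf ()) hg
  d_d {s t} f := by
    rcases s with _ | _ <;> rcases t with _ | _
    · rfl
    · ext (_ | _) <;> rfl
    · rfl
    · rfl
  d_comp {s t w k f} g hf := by
    -- the sign is invisible, since a nonzero multiple `r` of a unit has degree `0`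
    have key : ∀ {s' t' : Pt} (r : R) (g : Gen s' t' → R), (0 ≠ k → r = 0) →
        diff s' t' (r • g) = k.negOnePow • r • diff s' t' g := by
      intro s' t' r g hr
      by_cases hk : 0 = k
      · subst hk
        simp
      · simp [hr hk]
    rcases s with _ | _ <;> rcases t with _ | _
    · simp only [diff_src, LinearMap.zero_apply, map_zero, zero_add]
      exact key (f ()) g (hf ())
    · rcases w with _ | _
      · simp [comp_src_tgt_src, diff_src]
      · simp only [diff_tgt, LinearMap.zero_apply, map_zero, smul_zero, add_zero]
        exact map_smul (diff .src .tgt) (g ()) f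
    · simp [comp_tgt_src, diff_tgt]
    · simp only [diff_tgt, LinearMap.zero_apply, map_zero, smul_zero, add_zero]
  comp_assoc {s t w z} f g h := by
    rcases s with _ | _ <;> rcases t with _ | _
    · simp [comp_src]
    · rcases w with _ | _
      · simp [comp_src_tgt_src, comp_tgt_src]
      · rcases z with _ | _
        · simp [comp_src_tgt, comp_src_tgt_src, comp_tgt]
        · simp [comp_src_tgt, comp_tgt, smul_smul]
    · simp [comp_tgt_src]
    · simp [comp_tgt]
  d_one s := by rcases s with _ | _ <;> rfl
  one_comp {s t} f := by
    rcases s with _ | _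
    · exact (comp_src _ f).trans (one_smul R f)
    · exact (comp_tgt _ f).trans (one_smul R f)
  comp_one {s t} f := by
    rcases s with _ | _ <;> rcases t with _ | _
    · exact funext fun i => mul_one (f i)
    · exact (comp_src_tgt f _).trans (one_smul R f)
    · exact funext fun i => i.elim
    · exact funext fun i => mul_one (f i)

/-! ### Strings with a multiple of a unit -/

theorem GradedQuiver.IsMultilinear.map_smul {Q : GradedQuiver.{u, v} R} {x w y z : Q.Ob}
    {M : Type v} [AddCommGroup M] [Module R M] {φ : Q.HChain x w → M} (h : IsMultilinear φ)
    (a : Q.HChain x y) (n : ℤ) (r : R) (f : Q.gr y z n) (c : Q.HChain z w) :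
    φ (a.append (.cons ⟨n, r • f⟩ c)) = r • φ (a.append (.cons ⟨n, f⟩ c)) := by
  have h0 := h a n r f 0 c
  rwa [add_zero, h.map_zero, add_zero] at h0

namespace UnitalAInfCategory

/-- A homogeneous morphism is a scalar if it is zero or a multiple of a unit. -/
inductive IsScalar (B : UnitalAInfCategory.{u, v} R) : ∀ {x y : B.Ob}, B.HomogHom x y → Prop
  | zero {x y : B.Ob} (q : B.HomogHom x y) (hq : (q.2 : B.Hom x y) = 0) : IsScalar B q
  | smul_one (x : B.Ob) (r : R) : IsScalar B ⟨0, r • B.one x⟩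

theorem IsScalar.m_eq_zero {B : UnitalAInfCategory.{u, v} R} {x y z w : B.Ob}
    {q : B.HomogHom y z} (hq : B.IsScalar q) (a : B.HChain x y) (c : B.HChain z w)
    (h : a.length + 1 + c.length ≠ 2) : B.m (a.append (.cons q c)) = 0 := by
  cases hq with
  | zero _ hq => exact AInfCategory.m_insert_zero a q hq c
  | smul_one r =>
    rw [IsMultilinear.map_smul (B.m_multilinear x w), B.m_one a c h, smul_zero]

theorem IsScalar.map_eq_zero {A B : UnitalAInfCategory.{u, v} R} (F : UnitalAInfFunctor A B)
    {x y z w : A.Ob} {q : A.HomogHom y z} (hq : A.IsScalar q) (a : A.HChain x y)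
    (c : A.HChain z w) (h : 2 ≤ a.length + 1 + c.length) : F.map (a.append (.cons q c)) = 0 := by
  cases hq with
  | zero _ hq => exact F.map_insert_zero a q hq c
  | smul_one r =>
    rw [IsMultilinear.map_smul (F.map_multilinear x w), F.map_one a c h, smul_zero]

theorem IsScalar.hmap {A B : UnitalAInfCategory.{u, v} R}
    (F : FormalMorphism A.toGradedQuiver B.toGradedQuiver)
    (hF : ∀ x : A.Ob, F.map (.single ⟨0, A.one x⟩) = (B.one (F.obj x) : B.Hom _ _))
    {x y : A.Ob} {q : A.HomogHom x y} (hq : A.IsScalar q) : B.IsScalar (F.hmap (.single q)) := by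
  cases hq with
  | zero _ hq =>
    obtain ⟨n, f⟩ := q
    obtain rfl : f = 0 := Subtype.ext hq
    exact .zero _ (IsMultilinear.map_zero (F.map_multilinear x y) (.nil _) n (.nil _))
  | smul_one r =>
    have e : F.hmap (.single ⟨0, r • A.one x⟩) = ⟨0, r • B.one (F.obj x)⟩ := by
      refine homog_ext (by simp [FormalMorphism.hmap, degree, Chain.single, Chain.length]) ?_
      have h := IsMultilinear.map_smul (F.map_multilinear x x) (.nil _) 0 r (A.one x) (.nil _)
      exact h.trans (congrArg (r • ·) (hF x))
    exact e ▸ IsScalar.smul_one (B := B) (F.obj x) r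

end UnitalAInfCategory

namespace FormalMorphism

variable {P Q : GradedQuiver.{u, v} R}

/-- If `F` has no components on strings of length at least `2`, then only the cut into blocks of
length `1` contributes to a sum over all cuts. -/
theorem sum_cuts_of_strict (F : FormalMorphism P Q)
    (hF : ∀ {x y : P.Ob} (p : P.HChain x y), 2 ≤ p.length → F.map p = 0) {M : Type v}
    [AddCommGroup M] [Module R M] {x y : P.Ob} {w : Q.Ob} (p : P.HChain x y)
    {φ : Q.HChain w (F.obj y) → M} (hφ : IsMultilinear φ) (a : Q.HChain w (F.obj x)) :
    (p.cuts.map fun c => φ (a.append (F.blocks c))).sum =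
      φ (a.append (p.map F.obj fun f => F.hmap (.single f))) := by
  induction p with
  | nil x => simp [Chain.cuts, blocks, Chain.map]
  | @cons x y z f p ih =>
    rw [sum_cuts_cons]
    have assoc : ∀ {x y z w : Q.Ob} (a : Q.HChain x y) (q : Q.HomogHom y z) (c : Q.HChain z w),
        (a.append (.single q)).append c = a.append (.cons q c) := by
      intro x y z w a q c
      induction a with
      | nil => rfl
      | cons g a ih => exact congrArg (Chain.cons g) (ih _)
    have h := ih hφ (a.append (.single (F.hmap (.single f))))
    simp only [assoc] at h
    refine Eq.trans ?_ h
    refine congrArg List.sum (List.map_congr_left fun e he => ?_)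
    refine (add_eq_left.2 ?_)
    cases e with
    | nil => simp [Chain.growFirst]
    | cons b e =>
      have hb := Chain.length_pos_of_mem_cuts p b e he
      have h0 : F.map (.cons f b) = 0 := hF _ (by simp only [Chain.length]; omega)
      simp only [Chain.growFirst, List.map_cons, List.map_nil, List.sum_cons, List.sum_nil,
        add_zero]
      have e0 : F.hmap (.cons f b) = ⟨_, 0⟩ := homog_ext rfl h0
      exact (congrArg (fun q => φ (a.append (.cons q (F.blocks e)))) e0).trans
        (hφ.map_zero a _ (F.blocks e))

end FormalMorphism

theorem AInfCategory.m_m_single {A : AInfCategory.{u, v} R} {x y : A.Ob} (q : A.HomogHom x y) :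
    A.m (.single (A.hm (.single q))) = 0 := by
  have h := A.m_rel_hm (.single q)
  simpa [Chain.splits₃, Chain.splits, Chain.single, Chain.append, degree, Chain.length,
    m_cons_zero _ (hm_nil _), m_cons_cons_zero _ _ (hm_nil _)] using h

/-! ### Functors out of the test category -/

/-- The test category, as an `A∞`-category. -/
abbrev interval (R : Type v) [CommRing R] (n : ℤ) : UnitalAInfCategory.{u, v} R :=
  (intervalDG R n).toAInf

namespace IntervalCat

/-- An endomorphism in the test category is a scalar; in particular it is zero unless its degree
is `0`. -/
theorem isScalar_loop {n : ℤ} (s : Pt.{u}) (f : (interval R n).HomogHom s s) :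
    (interval R n).IsScalar f := by
  obtain ⟨k, f, hf⟩ := f
  have h1 : ∃ r : R, f = r • ((interval R n).one s).1 := by
    rcases s with _ | _
    · exact ⟨f (), funext fun i => (mul_one _).symm⟩
    · exact ⟨f (), funext fun i => (mul_one _).symm⟩
  have h2 : 0 ≠ k → f = 0 := by
    intro hk
    rcases s with _ | _
    · exact funext fun i => hf i hk
    · exact funext fun i => hf i hk
  by_cases hk : 0 = k
  · subst hk
    obtain ⟨r, rfl⟩ := h1
    exact .smul_one (B := interval R n) s r
  · exact .zero _ (h2 hk)

/-- Of two consecutive morphisms of the test category, one is a scalar. -/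
theorem isScalar_or {n : ℤ} {s t w : Pt.{u}} (f : (interval R n).HomogHom s t)
    (g : (interval R n).HomogHom t w) :
    (interval R n).IsScalar f ∨ (interval R n).IsScalar g := by
  rcases s with _ | _ <;> rcases t with _ | _
  · exact .inl (isScalar_loop _ f)
  · rcases w with _ | _
    · exact .inr (.zero _ (tgt_src_eq_zero _))
    · exact .inr (isScalar_loop _ g)
  · exact .inl (.zero _ (tgt_src_eq_zero _))
  · exact .inl (isScalar_loop _ f)

variable {B : UnitalAInfCategory.{u, v} R}

/-- The object map of the functor out of the test category. -/
def obj (x y : B.Ob) : Pt.{u} → B.Ob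
  | .src => x
  | .tgt => y

/-- The linear part of the functor out of the test category that sends the generator to `a`. -/
def lin {n : ℤ} {x y : B.Ob} (a : B.gr x y n) :
    (s t : Pt.{u}) → (Gen s t → R) →ₗ[R] B.Hom (obj x y s) (obj x y t)
  | .src, .src =>
    { toFun f := f () • (B.one x).1
      map_add' f g := add_smul _ _ _
      map_smul' r f := mul_smul _ _ _ }
  | .src, .tgt =>
    { toFun f := f false • a.1 + f true • B.m (.single ⟨n, a⟩)
      map_add' f g := by
        refine Eq.trans (congrArg₂ (· + ·) (add_smul _ _ _) (add_smul _ _ _)) ?_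
        exact add_add_add_comm _ _ _ _
      map_smul' r f := by
        refine Eq.trans (congrArg₂ (· + ·) (mul_smul _ _ _) (mul_smul _ _ _)) ?_
        exact (smul_add _ _ _).symm }
  | .tgt, .src => 0
  | .tgt, .tgt =>
    { toFun f := f () • (B.one y).1
      map_add' f g := add_smul _ _ _
      map_smul' r f := mul_smul _ _ _ }

variable {n : ℤ} {x y : B.Ob} (a : B.gr x y n)

theorem lin_src_tgt (f : Gen Pt.src.{u} .tgt → R) :
    lin a .src .tgt f = f false • a.1 + f true • B.m (.single ⟨n, a⟩) := rfl

theorem lin_one (s : Pt.{u}) :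
    lin a s s ((interval R n).one s).1 = (B.one (obj x y s)).1 := by
  rcases s with _ | _
  · exact one_smul R _
  · exact one_smul R _

theorem lin_mem {s t : Pt.{u}} (q : (interval R n).HomogHom s t) :
    lin a s t q.2.1 ∈ B.gr (obj x y s) (obj x y t) q.1 := by
  obtain ⟨k, f, hf⟩ := q
  have key : ∀ {x y : B.Ob} (l : ℤ) (r : R) (b : B.Hom x y), (l ≠ k → r = 0) → b ∈ B.gr x y l →
      r • b ∈ B.gr x y k := by
    intro x y l r b hr hb
    by_cases hk : l = k
    · subst hk
      exact Submodule.smul_mem _ _ hb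
    · rw [hr hk, zero_smul]
      exact zero_mem _
  rcases s with _ | _ <;> rcases t with _ | _
  · exact key 0 (f ()) _ (hf ()) (B.one x).2
  · refine add_mem (key n (f false) _ (hf false) a.2) (key (n + 1) (f true) _ (hf true) ?_)
    have h := (B.hm (.single ⟨n, a⟩)).2.2
    have e : (B.hm (.single ⟨n, a⟩)).1 = n + 1 := by
      simp [AInfCategory.hm, degree, Chain.single, Chain.length]; ring
    exact e ▸ h
  · exact zero_mem _
  · exact key 0 (f ()) _ (hf ()) (B.one y).2

/-- The components of the functor out of the test category: there are none on strings of length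
at least `2`. -/
def map : {s t : Pt.{u}} → (interval R n).HChain s t → B.Hom (obj x y s) (obj x y t)
  | _, _, .nil _ => 0
  | _, _, .cons f (.nil _) => lin a _ _ f.2.1
  | _, _, .cons _ (.cons _ _) => 0

theorem map_eq_zero {s t : Pt.{u}} (p : (interval R n).HChain s t) (hp : p.length ≠ 1) :
    map a p = 0 := by
  rcases p with _ | ⟨f, _ | ⟨g, p⟩⟩
  · rfl
  · simp [Chain.length] at hp
  · rfl

/-- The formal morphism underlying the functor out of the test category. -/
def formal : FormalMorphism (interval R n).toGradedQuiver B.toGradedQuiver where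
  obj := obj x y
  map := map a
  map_nil _ := rfl
  map_mem p := by
    rcases p with _ | ⟨f, _ | ⟨g, p⟩⟩
    · exact zero_mem _
    · have h := lin_mem a f
      have e : degree (Chain.cons f (.nil _)) + 1 - (Chain.cons f (.nil _)).length = f.1 := by
        simp [degree, Chain.length]
      exact e ▸ h
    · exact zero_mem _
  map_multilinear s t := by
    intro y z b k r f g c
    rcases b with _ | ⟨h, _ | ⟨h', b⟩⟩ <;> rcases c with _ | ⟨k, c⟩
    · exact ((lin a _ _).map_add _ _).trans (congrArg (· + _) ((lin a _ _).map_smul _ _))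
    all_goals simp [Chain.append, map]

theorem hmap_formal {s t : Pt.{u}} (q : (interval R n).HomogHom s t) :
    (formal a).hmap (.single q) = ⟨q.1, lin a s t q.2.1, lin_mem a q⟩ :=
  homog_ext (by simp [FormalMorphism.hmap, degree, Chain.single, Chain.length]) rfl

theorem isScalar_hmap {s t : (interval.{u} R n).Ob} {q : (interval R n).HomogHom s t}
    (hq : (interval R n).IsScalar q) : B.IsScalar ((formal a).hmap (.single q)) :=
  hq.hmap (formal a) (lin_one a)

theorem m_lin_of_isScalar {s t : (interval.{u} R n).Ob} {q : (interval R n).HomogHom s t}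
    (hq : (interval R n).IsScalar q) :
    B.m (.single ((formal a).hmap (.single q))) = lin a s t ((interval R n).m (.single q)) := by
  have h1 := (isScalar_hmap a hq).m_eq_zero (.nil _) (.nil _) (by simp [Chain.length])
  have h2 := hq.m_eq_zero (.nil _) (.nil _) (by simp [Chain.length])
  exact h1.trans ((congrArg (lin a s t) h2).trans (map_zero _)).symm

theorem m_lin {s t : Pt.{u}} (q : (interval R n).HomogHom s t) :
    B.m (.single ((formal a).hmap (.single q))) = lin a s t ((interval R n).m (.single q)) := by
  rcases s with _ | _ <;> rcases t with _ | _
  · exact m_lin_of_isScalar a (isScalar_loop _ q)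
  · obtain ⟨k, f, hf⟩ := q
    have e : lin a .src .tgt ((interval R n).m (.single ⟨k, f, hf⟩)) =
        f false • B.m (.single ⟨n, a⟩) := by
      refine (lin_src_tgt a _).trans ?_
      exact (congrArg (· + _) (zero_smul R _)).trans (zero_add _)
    rw [e, hmap_formal]
    by_cases h : n = k
    · subst h
      have h1 : f true = 0 := hf true (by simp [deg])
      have h2 : (⟨n, lin a .src .tgt f, lin_mem a ⟨n, f, hf⟩⟩ : B.HomogHom x y) =
          ⟨n, f false • a⟩ := homog_ext rfl (by
        refine (lin_src_tgt a f).trans ?_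
        rw [h1, zero_smul, add_zero]
        rfl)
      refine (congrArg (fun q => B.m (.single q)) h2).trans ?_
      exact IsMultilinear.map_smul (B.m_multilinear x y) (.nil _) n _ a (.nil _)
    · have h1 : f false = 0 := hf false h
      rw [h1, zero_smul]
      by_cases h' : n + 1 = k
      · have h2 : (⟨k, lin a .src .tgt f, lin_mem a ⟨k, f, hf⟩⟩ : B.HomogHom x y) =
            ⟨_, f true • (B.hm (.single ⟨n, a⟩)).2⟩ := homog_ext (by
          simp [AInfCategory.hm, degree, Chain.single, Chain.length]; omega) (by
          refine (lin_src_tgt a f).trans ?_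
          rw [h1, zero_smul, zero_add]
          rfl)
        refine (congrArg (fun q => B.m (.single q)) h2).trans ?_
        refine (IsMultilinear.map_smul (B.m_multilinear x y) (.nil _) _ _
          (B.hm (.single ⟨n, a⟩)).2 (.nil _)).trans ?_
        exact (congrArg _ (AInfCategory.m_m_single _)).trans (smul_zero _)
      · refine AInfCategory.m_cons_zero _ ?_ (.nil _)
        refine (lin_src_tgt a f).trans ?_
        rw [h1, hf true h', zero_smul, zero_smul, add_zero]
        rfl
  · exact m_lin_of_isScalar a (.zero _ (tgt_src_eq_zero _))
  · exact m_lin_of_isScalar a (isScalar_loop _ q)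

/-- The relation for strings of length `2`, when the first morphism is a scalar. -/
theorem m_lin_lin_left {s t w : (interval.{u} R n).Ob} {f : (interval R n).HomogHom s t}
    (g : (interval R n).HomogHom t w) (hf : (interval R n).IsScalar f) :
    B.m (.cons ((formal a).hmap (.single f)) (.single ((formal a).hmap (.single g)))) =
      lin a s w ((interval R n).m (.cons f (.single g))) := by
  have hf' := isScalar_hmap a hf
  cases hf with
  | zero _ hf =>
    have h1 := AInfCategory.m_cons_zero f hf (.single g)
    have h2 : lin a s t f.2.1 = 0 := (congrArg (lin a s t) hf).trans (map_zero _)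
    exact (AInfCategory.m_cons_zero _ h2 _).trans
      ((congrArg (lin a s w) h1).trans (map_zero _)).symm
  | smul_one r =>
    have h1 := IsMultilinear.map_smul ((interval R n).m_multilinear s w) (.nil _) 0 r
      ((interval R n).one s) (.single g)
    have e : (formal a).hmap (.single ⟨0, r • (interval R n).one s⟩) =
        ⟨0, r • B.one (obj x y s)⟩ := by
      rw [hmap_formal]
      exact homog_ext rfl (((lin a s s).map_smul r _).trans (congrArg (r • ·) (lin_one a s)))
    have h2 := IsMultilinear.map_smul (B.m_multilinear (obj x y s) (obj x y w)) (.nil _) 0 r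
      (B.one (obj x y s)) (.single ((formal a).hmap (.single g)))
    have h3 := (interval R n).m_one_right g.1 g.2
    have h4 := B.m_one_right _ ((formal a).hmap (.single g)).2
    rw [e]
    refine h2.trans ((congrArg (r • ·) h4).trans ?_)
    refine Eq.trans ?_ (congrArg (lin a s w) (h1.trans (congrArg (r • ·) h3))).symm
    exact ((lin a s w).map_smul r _).symm

/-- The relation for strings of length `2`, when the second morphism is a scalar. -/
theorem m_lin_lin_right {s t w : (interval.{u} R n).Ob} (f : (interval R n).HomogHom s t)
    {g : (interval R n).HomogHom t w} (hg : (interval R n).IsScalar g) :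
    B.m (.cons ((formal a).hmap (.single f)) (.single ((formal a).hmap (.single g)))) =
      lin a s w ((interval R n).m (.cons f (.single g))) := by
  cases hg with
  | zero _ hg =>
    have h1 := AInfCategory.m_cons_cons_zero f g hg (.nil _)
    have h2 : lin a t w g.2.1 = 0 := (congrArg (lin a t w) hg).trans (map_zero _)
    exact (AInfCategory.m_cons_cons_zero _ _ h2 _).trans
      ((congrArg (lin a s w) h1).trans (map_zero _)).symm
  | smul_one r =>
    have h1 := IsMultilinear.map_smul ((interval R n).m_multilinear s t) (.single f) 0 r
      ((interval R n).one t) (.nil _)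
    have e : (formal a).hmap (.single ⟨0, r • (interval R n).one t⟩) =
        ⟨0, r • B.one (obj x y t)⟩ := by
      rw [hmap_formal]
      exact homog_ext rfl (((lin a t t).map_smul r _).trans (congrArg (r • ·) (lin_one a t)))
    have h2 := IsMultilinear.map_smul (B.m_multilinear (obj x y s) (obj x y t))
      (.single ((formal a).hmap (.single f))) 0 r (B.one (obj x y t)) (.nil _)
    have h3 := (interval R n).m_one_left f.1 f.2
    have h4 := B.m_one_left f.1 ⟨_, lin_mem a f⟩
    rw [e]
    rw [hmap_formal] at h2 ⊢
    refine h2.trans ((congrArg (r • ·) h4).trans ?_)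
    refine Eq.trans ?_ (congrArg (lin a s t) (h1.trans (congrArg (r • ·) h3))).symm
    refine Eq.trans ?_ ((lin a s t).map_smul r _).symm
    exact congrArg (r • ·) (map_zsmul_unit (lin a s t) _ _).symm

theorem m_lin_lin {s t w : Pt.{u}} (f : (interval R n).HomogHom s t)
    (g : (interval R n).HomogHom t w) :
    B.m (.cons ((formal a).hmap (.single f)) (.single ((formal a).hmap (.single g)))) =
      lin a s w ((interval R n).m (.cons f (.single g))) := by
  rcases isScalar_or f g with h | h
  · exact m_lin_lin_left a g h
  · exact m_lin_lin_right a f h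

theorem formal_rel {s t : Pt.{u}} (p : (interval R n).HChain s t) :
    (p.cuts.map fun c => B.m ((formal a).blocks c)).sum =
      (p.splits₃.map fun s => (degree s.fst - s.fst.length).negOnePow •
        map a (s.fst.append (.cons ((interval R n).hm s.mid) s.lst))).sum := by
  have h := (formal a).sum_cuts_of_strict
    (fun p hp => map_eq_zero a p (by omega)) p (B.m_multilinear (obj x y s) (obj x y t))
    (.nil _)
  refine Eq.trans h ?_
  simp only [Chain.append]
  rcases p with _ | ⟨f, _ | ⟨g, _ | ⟨k, p⟩⟩⟩
  · simp only [Chain.splits₃, Chain.splits, Chain.append, List.flatMap_cons, List.flatMap_nil,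
      List.map_cons, List.map_nil, List.append_nil, List.sum_cons, List.sum_nil, add_zero]
    refine (B.m_nil _).trans (Eq.symm ?_)
    exact (congrArg _ (map_zero (lin a _ _))).trans (smul_zero _)
  · refine (m_lin a f).trans ?_
    simp only [Chain.splits₃, Chain.splits, Chain.append, List.flatMap_cons, List.flatMap_nil,
      List.map_cons, List.map_nil, List.append_nil, List.sum_cons, List.sum_nil, add_zero,
      List.cons_append, List.nil_append, map, smul_zero, zero_add]
    exact (one_smul ℤˣ _).symm
  · refine (m_lin_lin a f g).trans ?_
    simp only [Chain.splits₃, Chain.splits, Chain.append, List.flatMap_cons, List.flatMap_nil,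
      List.map_cons, List.map_nil, List.append_nil, List.sum_cons, List.sum_nil, add_zero,
      List.cons_append, List.nil_append, map, smul_zero, zero_add]
    exact (one_smul ℤˣ _).symm
  · refine Eq.trans ?_ (List.sum_eq_zero ?_).symm
    · rcases isScalar_or f g with h | h
      · exact (isScalar_hmap a h).m_eq_zero (.nil _) _
          (by simp only [Chain.map, Chain.length]; omega)
      · exact (isScalar_hmap a h).m_eq_zero
          (.single ((formal a).hmap (.single f))) _
          (by simp only [Chain.map, Chain.length, Chain.single]; omega)
    -- if only one arrow is left after the inner operation, then the latter has length `≥ 3`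
    · intro t ht
      obtain ⟨⟨y, z, b, q, c⟩, hs, rfl⟩ := List.mem_map.1 ht
      have hl := Chain.length_of_mem_splits₃ _ _ hs
      rcases b with _ | ⟨f', _ | ⟨g', b⟩⟩ <;> rcases c with _ | ⟨k', c⟩
      · have hq : 3 ≤ q.length := by simp only [Chain.length] at hl; omega
        have h0 : (intervalDG R n).op q = 0 := (intervalDG R n).op_eq_zero q hq
        exact (congrArg _ ((congrArg (lin a _ _) h0).trans (map_zero (lin a _ _)))).trans
          (smul_zero (A := B.Hom _ _) _)
      all_goals
        simp only [Chain.append, map, smul_zero]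
        rfl

/-- The strictly unital functor out of the test category that sends the generator to `a`. -/
def functor : UnitalAInfFunctor (interval R n) B where
  toFormalMorphism := formal a
  map_rel := formal_rel a
  map_one_single := lin_one a
  map_one b c h := by
    rcases b with _ | ⟨f, _ | ⟨g, b⟩⟩ <;> rcases c with _ | ⟨k, c⟩
    · simp [Chain.length] at h
    all_goals rfl

end IntervalCat

/-! ### Transport along equalities of objects -/

/-- Transport of morphisms along equalities of objects. -/
def GradedQuiver.cast (Q : GradedQuiver.{u, v} R) {x x' y y' : Q.Ob} (hx : x = x') (hy : y = y') :
    Q.Hom x y →ₗ[R] Q.Hom x' y' :=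
  match x', y', hx, hy with
  | _, _, rfl, rfl => LinearMap.id

namespace GradedQuiver

variable {Q : GradedQuiver.{u, v} R}

@[simp]
theorem cast_self {x y : Q.Ob} (hx : x = x) (hy : y = y) (f : Q.Hom x y) : Q.cast hx hy f = f :=
  rfl

theorem cast_mem {x x' y y' : Q.Ob} (hx : x = x') (hy : y = y') {n : ℤ} {f : Q.Hom x y} :
    Q.cast hx hy f ∈ Q.gr x' y' n ↔ f ∈ Q.gr x y n := by
  subst hx hy
  rfl

/-- Transport of homogeneous morphisms along equalities of objects. -/
def castGr {x x' y y' : Q.Ob} (hx : x = x') (hy : y = y') {n : ℤ} :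
    Q.gr x y n →ₗ[R] Q.gr x' y' n :=
  (Q.cast hx hy).restrict fun _ hf => (cast_mem hx hy).2 hf

end GradedQuiver

namespace FormalMorphism

variable {P Q S : GradedQuiver.{u, v} R}

theorem ext_of_cast {K K' : FormalMorphism P Q} (ho : ∀ x, K.obj x = K'.obj x)
    (hm : ∀ {x y : P.Ob} (p : P.HChain x y), Q.cast (ho x) (ho y) (K.map p) = K'.map p) :
    K = K' := by
  obtain ⟨o, m, _, _, _⟩ := K
  obtain ⟨o', m', _, _, _⟩ := K'
  obtain rfl : o = o' := funext ho
  obtain rfl : @m = @m' := by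
    funext x y p
    exact hm p
  rfl

theorem cast_map_of_eq {K K' : FormalMorphism P Q} (h : K = K') {x y : P.Ob} (p : P.HChain x y)
    (hx : K.obj x = K'.obj x) (hy : K.obj y = K'.obj y) :
    Q.cast hx hy (K.map p) = K'.map p := by
  subst h
  rfl

theorem hmap_single (F : FormalMorphism P Q) {x y : P.Ob} (q : P.HomogHom x y) :
    F.hmap (.single q) = ⟨q.1, F.lin x y q.1 q.2⟩ :=
  homog_ext (by simp [hmap, degree, Chain.single, Chain.length]) rfl

theorem comp_map_single (G : FormalMorphism Q S) (F : FormalMorphism P Q) {x y : P.Ob}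
    (q : P.HomogHom x y) : (G.comp F).map (.single q) = G.map (.single (F.hmap (.single q))) := by
  simp [comp, Chain.single, Chain.cuts, Chain.growFirst, blocks, Chain.map]

theorem lin_castGr (F : FormalMorphism P Q) {x x' y y' : P.Ob} (hx : x = x') (hy : y = y') {n : ℤ}
    (f : P.gr x y n) : (F.lin x' y' n (castGr hx hy f) : Q.Hom _ _) =
      Q.cast (congrArg F.obj hx) (congrArg F.obj hy) (F.lin x y n f) := by
  subst hx hy
  rfl

end FormalMorphism

/-! ### Characterization of the functors out of the test category -/

namespace IntervalCat

/-- The generator of the test category. -/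
def gen (R : Type v) [CommRing R] (n : ℤ) : (interval.{u} R n).gr Pt.src Pt.tgt n :=
  ⟨fun i => Bool.rec 1 0 i, by
    rintro (_ | _) h
    · exact absurd rfl h
    · rfl⟩

variable {B C : UnitalAInfCategory.{u, v} R} {n : ℤ}

/-- The properties of a strictly unital functor out of the test category on which its
characterization relies. They are stated for formal morphisms, because composites of
`A∞`-functors are only formed as such. -/
structure IsTest (K : FormalMorphism (interval.{u} R n).toGradedQuiver B.toGradedQuiver) :
    Prop where
  map_eq_zero : ∀ {s t : (interval.{u} R n).Ob} (p : (interval R n).HChain s t), 2 ≤ p.length →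
    K.map p = 0
  map_one_single : ∀ s : (interval.{u} R n).Ob,
    K.map (.single ⟨0, (interval R n).one s⟩) = (B.one (K.obj s) : B.Hom _ _)
  m_map : ∀ {s t : (interval.{u} R n).Ob} (q : (interval R n).HomogHom s t),
    B.m (.single (K.hmap (.single q))) = K.map (.single ((interval R n).hm (.single q)))

theorem isTest_functor (N : UnitalAInfFunctor (interval.{u} R n) B) :
    IsTest N.toFormalMorphism where
  map_eq_zero {s t} p hp := by
    rcases p with _ | ⟨f, _ | ⟨g, p⟩⟩
    · simp [Chain.length] at hp
    · simp [Chain.length] at hp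
    · rcases isScalar_or f g with h | h
      · exact h.map_eq_zero N (.nil _) _ (by simp only [Chain.length]; omega)
      · exact h.map_eq_zero N (.single f) _ (by simp only [Chain.single, Chain.length]; omega)
  map_one_single := N.map_one_single
  m_map q := by
    obtain ⟨k, f⟩ := q
    rw [AInfFunctor.hmap_single]
    exact N.map_rel_one f

theorem IsTest.comp {K : FormalMorphism (interval.{u} R n).toGradedQuiver B.toGradedQuiver}
    (hK : IsTest K) (G : UnitalAInfFunctor B C) : IsTest (G.toFormalMorphism.comp K) where
  map_eq_zero {s t} p hp := by
    have h := K.sum_cuts_of_strict hK.map_eq_zero p (G.map_multilinear (K.obj s) (K.obj t))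
      (.nil _)
    refine Eq.trans h ?_
    rcases p with _ | ⟨f, _ | ⟨g, p⟩⟩
    · simp [Chain.length] at hp
    · simp [Chain.length] at hp
    · rcases isScalar_or f g with h | h
      · exact (h.hmap K hK.map_one_single).map_eq_zero G (.nil _) _
          (by simp only [Chain.map, Chain.length]; omega)
      · exact (h.hmap K hK.map_one_single).map_eq_zero G (.single (K.hmap (.single f))) _
          (by simp only [Chain.single, Chain.length]; omega)
  map_one_single s := by
    refine (FormalMorphism.comp_map_single _ _ _).trans (Eq.trans ?_ (G.map_one_single _))
    refine congrArg (fun q => G.map (.single q)) (homog_ext ?_ (hK.map_one_single s))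
    simp [FormalMorphism.hmap, degree, Chain.single, Chain.length]
  m_map {s t} q := by
    have h1 := G.map_rel_one (K.hmap (.single q)).2
    have h2 : (G.toFormalMorphism.comp K).hmap (.single q) =
        ⟨(K.hmap (.single q)).1, G.lin _ _ _ (K.hmap (.single q)).2⟩ :=
      homog_ext (by simp [FormalMorphism.hmap, degree, Chain.single, Chain.length])
        (FormalMorphism.comp_map_single _ _ _)
    refine (congrArg (fun q => C.m (.single q)) h2).trans (h1.trans ?_)
    refine Eq.trans ?_ (FormalMorphism.comp_map_single _ _ _).symm
    refine congrArg (fun q => G.map (.single q)) ?_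
    refine homog_ext ?_ (hK.m_map q)
    simp [FormalMorphism.hmap, AInfCategory.hm, degree, Chain.single, Chain.length]

theorem map_gen {x y : B.Ob} (a : B.gr x y n) :
    (functor a).map (.single ⟨n, gen R n⟩) = (a : B.Hom x y) := by
  refine (lin_src_tgt a _).trans ?_
  refine (congrArg₂ (· + ·) (one_smul R _) (zero_smul R _)).trans (add_zero _)

/-- A homogeneous morphism from `src` to `tgt` is zero, or a multiple of the generator or of its
differential. -/
theorem homog_src_tgt (q : (interval.{u} R n).HomogHom .src .tgt) :
    ((q.2 : (interval.{u} R n).Hom .src .tgt) = 0) ∨ (∃ r : R, q = ⟨n, r • gen R n⟩) ∨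
      ∃ r : R, q = ⟨_, r • ((interval.{u} R n).hm (.single ⟨n, gen R n⟩)).2⟩ := by
  obtain ⟨k, f, hf⟩ := q
  by_cases h : n = k
  · refine .inr (.inl ⟨f false, homog_ext h.symm (funext ?_)⟩)
    rintro (_ | _)
    · exact (mul_one _).symm
    · exact (hf true (by simp [deg, h])).trans (mul_zero _).symm
  · by_cases h' : n + 1 = k
    · refine .inr (.inr ⟨f true, homog_ext ?_ (funext ?_)⟩)
      · simp [AInfCategory.hm, degree, Chain.single, Chain.length]
        omega
      · rintro (_ | _)
        · exact (hf false h).trans (mul_zero _).symm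
        · exact (mul_one _).symm
    · refine .inl (funext ?_)
      rintro (_ | _)
      · exact hf false h
      · exact hf true h'

/-- A strictly unital functor out of the test category is determined by its value on the
generator. -/
theorem IsTest.eq_functor
    {K : FormalMorphism (interval.{u} R n).toGradedQuiver B.toGradedQuiver}
    (hK : IsTest K) {x y : B.Ob} (hx : K.obj .src = x) (hy : K.obj .tgt = y) (a : B.gr x y n)
    (ha : B.cast hx hy (K.map (.single ⟨n, gen R n⟩)) = a) :
    K = (functor a).toFormalMorphism := by
  subst hx hy
  have hN := isTest_functor (functor a)
  have ho : ∀ s, K.obj s = (functor a).obj s := fun s => by rcases s with _ | _ <;> rfl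
  refine FormalMorphism.ext_of_cast ho ?_
  intro s t p
  rcases p with _ | ⟨q, _ | ⟨q', p⟩⟩
  · rw [K.map_nil, map_zero]
    exact ((functor a).map_nil _).symm
  · refine Eq.trans (b := B.cast (ho s) (ho t) (K.map (.single q))) rfl ?_
    have hzero : ∀ (s t : (interval.{u} R n).Ob) (q : (interval R n).HomogHom s t),
        (q.2 : (interval R n).Hom s t) = 0 →
        B.cast (ho s) (ho t) (K.map (.single q)) = (functor a).map (.single q) := by
      rintro s t ⟨k, f⟩ hf
      obtain rfl : f = 0 := Subtype.ext hf
      have h1 := IsMultilinear.map_zero (K.map_multilinear s t) (.nil _) k (.nil _)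
      have h2 := IsMultilinear.map_zero ((functor a).map_multilinear s t) (.nil _) k (.nil _)
      exact (congrArg _ h1).trans ((map_zero _).trans h2.symm)
    have hsmul : ∀ (s t : (interval.{u} R n).Ob) (k : ℤ) (r : R) (f : (interval R n).gr s t k),
        B.cast (ho s) (ho t) (K.map (.single ⟨k, f⟩)) = (functor a).map (.single ⟨k, f⟩) →
        B.cast (ho s) (ho t) (K.map (.single ⟨k, r • f⟩)) =
          (functor a).map (.single ⟨k, r • f⟩) := by
      intro s t k r f hf
      have h1 := IsMultilinear.map_smul (K.map_multilinear s t) (.nil _) k r f (.nil _)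
      have h2 := IsMultilinear.map_smul ((functor a).map_multilinear s t) (.nil _) k r f (.nil _)
      refine (congrArg _ h1).trans ((LinearMap.map_smul _ _ _).trans ?_)
      exact (congrArg (r • ·) hf).trans h2.symm
    have hloop : ∀ (s : (interval.{u} R n).Ob) (q : (interval R n).HomogHom s s),
        B.cast (ho s) (ho s) (K.map (.single q)) = (functor a).map (.single q) := by
      intro s q
      have hq := isScalar_loop s q
      cases hq with
      | zero _ hq => exact hzero s s q hq
      | smul_one r =>
        refine hsmul s s 0 r _ ?_
        refine (congrArg _ (hK.map_one_single s)).trans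
          (Eq.trans ?_ (hN.map_one_single s).symm)
        rcases s with _ | _ <;> rfl
    have hgen : K.map (.single ⟨n, gen R n⟩) = (functor a).map (.single ⟨n, gen R n⟩) :=
      ha.trans (map_gen a).symm
    rcases s with _ | _ <;> rcases t with _ | _
    · exact hloop _ q
    · obtain hq | ⟨r, rfl⟩ | ⟨r, rfl⟩ := homog_src_tgt q
      · exact hzero _ _ q hq
      · exact hsmul _ _ n r _ hgen
      · refine hsmul _ _ _ r _ ?_
        refine (hK.m_map ⟨n, gen R n⟩).symm.trans
          (Eq.trans ?_ (hN.m_map ⟨n, gen R n⟩))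
        refine congrArg (fun q => B.m (.single q)) ?_
        exact homog_ext rfl hgen
    · exact hzero _ _ q (tgt_src_eq_zero _)
    · exact hloop _ q
  · rw [hK.map_eq_zero _ (by simp only [Chain.length]; omega), map_zero]
    exact (hN.map_eq_zero _ (by simp only [Chain.length]; omega)).symm

end IntervalCat

/-! ### Objects and morphisms of a pullback -/

namespace IsAInfPullback

variable {P A A' A'' : UnitalAInfCategory.{u, v} R} {α : UnitalAInfFunctor P A''}
  {β : UnitalAInfFunctor P A} {F : UnitalAInfFunctor A A'} {G : UnitalAInfFunctor A'' A'}

open IntervalCat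

theorem obj_eq (hP : IsAInfPullback α β F G) (p : P.Ob) :
    F.obj (β.obj p) = G.obj (α.obj p) :=
  (congrFun (congrArg FormalMorphism.obj hP.comm) p).symm

theorem cast_comp_map (hP : IsAInfPullback α β F G) {p q : P.Ob} (c : P.HChain p q) :
    A'.cast (hP.obj_eq p) (hP.obj_eq q) ((F.toFormalMorphism.comp β.toFormalMorphism).map c) =
      (G.toFormalMorphism.comp α.toFormalMorphism).map c :=
  FormalMorphism.cast_map_of_eq hP.comm.symm c _ _

theorem cast_lin (hP : IsAInfPullback α β F G) {p q : P.Ob} {n : ℤ} (c : P.gr p q n) :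
    A'.cast (hP.obj_eq p) (hP.obj_eq q) (F.lin _ _ n (β.lin p q n c)).1 =
      (G.lin _ _ n (α.lin p q n c)).1 := by
  have h := hP.cast_comp_map (.single ⟨n, c⟩)
  rwa [FormalMorphism.comp_map_single, FormalMorphism.comp_map_single,
    FormalMorphism.hmap_single, FormalMorphism.hmap_single] at h

/-- A functor out of the test category into the fiber product is a pair of functors that have the
same value on the generator. -/
theorem existsUnique_functor (hP : IsAInfPullback α β F G) {x y : A.Ob} {x'' y'' : A''.Ob}
    (hx : F.obj x = G.obj x'') (hy : F.obj y = G.obj y'') {n : ℤ} (a : A.gr x y n)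
    (a'' : A''.gr x'' y'' n) (h : A'.cast hx hy (F.lin x y n a).1 = (G.lin x'' y'' n a'').1) :
    ∃! N : UnitalAInfFunctor (interval.{u} R n) P,
      α.toFormalMorphism.comp N.toFormalMorphism = (functor a'').toFormalMorphism ∧
      β.toFormalMorphism.comp N.toFormalMorphism = (functor a).toFormalMorphism := by
  refine hP.existsUnique_lift _ (functor a'') (functor a) ?_
  have h1 := ((isTest_functor (functor a'')).comp G).eq_functor rfl rfl (G.lin x'' y'' n a'') (by
    rw [FormalMorphism.comp_map_single, FormalMorphism.hmap_single]
    refine (cast_self _ _ _).trans ?_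
    exact congrArg (fun q => G.map (.single q)) (homog_ext rfl (map_gen a'')))
  have h2 := ((isTest_functor (functor a)).comp F).eq_functor hx hy (G.lin x'' y'' n a'') (by
    rw [FormalMorphism.comp_map_single, FormalMorphism.hmap_single]
    refine Eq.trans (congrArg _ ?_) h
    exact congrArg (fun q => F.map (.single q)) (homog_ext rfl (map_gen a)))
  exact h1.trans h2.symm

/-- Composing the functor that classifies `b` with `K` gives the one that classifies `K¹ b`. -/
theorem comp_functor {B C : UnitalAInfCategory.{u, v} R} (K : UnitalAInfFunctor B C) {x y : B.Ob}
    {n : ℤ} (b : B.gr x y n) {x' y' : C.Ob} (hx : K.obj x = x') (hy : K.obj y = y')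
    (c : C.gr x' y' n) (hc : C.cast hx hy (K.lin x y n b).1 = c.1) :
    K.toFormalMorphism.comp (functor b).toFormalMorphism = (functor c).toFormalMorphism := by
  refine ((isTest_functor (functor b)).comp K).eq_functor hx hy c ?_
  rw [FormalMorphism.comp_map_single, FormalMorphism.hmap_single]
  refine Eq.trans (congrArg _ ?_) hc
  exact congrArg (fun q => K.map (.single q)) (homog_ext rfl (map_gen b))

theorem obj_ext (hP : IsAInfPullback α β F G) {p p' : P.Ob} (h1 : α.obj p = α.obj p')
    (h2 : β.obj p = β.obj p') : p = p' := by
  have hc : A'.cast (hP.obj_eq p') (hP.obj_eq p') (F.lin _ _ 0 (0 : A.gr _ _ 0)).1 =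
      (G.lin (α.obj p') (α.obj p') 0 0).1 := by simp
  have hN := (hP.existsUnique_functor _ _ _ _ hc).unique
    (y₁ := functor (0 : P.gr p p 0)) (y₂ := functor (0 : P.gr p' p' 0))
    ⟨comp_functor α 0 h1 h1 0 (by simp), comp_functor β 0 h2 h2 0 (by simp)⟩
    ⟨comp_functor α 0 rfl rfl 0 (by simp), comp_functor β 0 rfl rfl 0 (by simp)⟩
  exact congrArg (fun N : UnitalAInfFunctor (interval.{u} R 0) P => N.obj .src) hN

theorem exists_obj (hP : IsAInfPullback α β F G) {x : A.Ob} {x'' : A''.Ob}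
    (hx : F.obj x = G.obj x'') : ∃ p : P.Ob, α.obj p = x'' ∧ β.obj p = x := by
  obtain ⟨N, ⟨h1, h2⟩, -⟩ := hP.existsUnique_functor hx hx (0 : A.gr x x 0) 0 (by simp)
  exact ⟨N.obj .src, congrFun (congrArg FormalMorphism.obj h1) .src,
    congrFun (congrArg FormalMorphism.obj h2) .src⟩

/-- A morphism of the pullback is determined by its images under the linear parts of `α` and `β`.
-/
theorem lin_ext (hP : IsAInfPullback α β F G) {p q : P.Ob} {n : ℤ} {c c' : P.gr p q n}
    (h1 : α.lin p q n c = α.lin p q n c') (h2 : β.lin p q n c = β.lin p q n c') : c = c' := by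
  have hN := (hP.existsUnique_functor _ _ _ _ (hP.cast_lin c')).unique
    (y₁ := functor c) (y₂ := functor c')
    ⟨comp_functor α c rfl rfl _ (congrArg Subtype.val h1),
      comp_functor β c rfl rfl _ (congrArg Subtype.val h2)⟩
    ⟨comp_functor α c' rfl rfl _ rfl, comp_functor β c' rfl rfl _ rfl⟩
  have h := FormalMorphism.cast_map_of_eq
    (congrArg (fun N : UnitalAInfFunctor (interval.{u} R n) P => N.toFormalMorphism) hN)
    (.single ⟨n, gen R n⟩) rfl rfl
  exact Subtype.ext ((map_gen c).symm.trans (h.trans (map_gen c')))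

/-- Morphisms of `A` and `A''` with the same image in `A'` under the linear parts of `F` and `G`
can be glued to a morphism of the pullback. -/
theorem exists_lin (hP : IsAInfPullback α β F G) {p q : P.Ob} {n : ℤ}
    (a : A.gr (β.obj p) (β.obj q) n) (a'' : A''.gr (α.obj p) (α.obj q) n)
    (h : A'.cast (hP.obj_eq p) (hP.obj_eq q) (F.lin _ _ n a).1 = (G.lin _ _ n a'').1) :
    ∃ c : P.gr p q n, α.lin p q n c = a'' ∧ β.lin p q n c = a := by
  obtain ⟨N, ⟨h1, h2⟩, -⟩ := hP.existsUnique_functor _ _ a a'' h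
  have o1 := congrFun (congrArg FormalMorphism.obj h1)
  have o2 := congrFun (congrArg FormalMorphism.obj h2)
  have hp : N.obj .src = p := hP.obj_ext (o1 .src) (o2 .src)
  have hq : N.obj .tgt = q := hP.obj_ext (o1 .tgt) (o2 .tgt)
  refine ⟨castGr hp hq (N.lin .src .tgt n (gen R n)), Subtype.ext ?_, Subtype.ext ?_⟩
  · have e := FormalMorphism.cast_map_of_eq h1 (.single ⟨n, gen R n⟩) (o1 .src) (o1 .tgt)
    rw [FormalMorphism.comp_map_single, FormalMorphism.hmap_single] at e
    exact (FormalMorphism.lin_castGr _ _ _ _).trans (e.trans (map_gen a''))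
  · have e := FormalMorphism.cast_map_of_eq h2 (.single ⟨n, gen R n⟩) (o2 .src) (o2 .tgt)
    rw [FormalMorphism.comp_map_single, FormalMorphism.hmap_single] at e
    exact (FormalMorphism.lin_castGr _ _ _ _).trans (e.trans (map_gen a))

end IsAInfPullback

/-! ### Differentials and products of homogeneous morphisms -/

namespace AInfCategory

variable {A : AInfCategory.{u, v} R} {x y z : A.Ob} {n k l : ℤ}

/-- The differential `m¹` as a map between homogeneous parts. -/
def δ (h : n + 1 = k) : A.gr x y n →ₗ[R] A.gr x y k :=
  (A.d x y n).codRestrict (A.gr x y k) fun f => by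
    have e : degree (.single ⟨n, f⟩ : A.HChain x y) + 2 -
        Chain.length (.single ⟨n, f⟩ : A.HChain x y) = k := by
      simp [Chain.single, degree, Chain.length]
      omega
    exact e ▸ A.m_mem (.single ⟨n, f⟩)

theorem hm_single_eq (h : n + 1 = k) (f : A.gr x y n) : A.hm (.single ⟨n, f⟩) = ⟨k, δ h f⟩ :=
  hm_single rfl h

theorem mem_cocycles_iff (h : n + 1 = k) {f : A.gr x y n} : f ∈ A.cocycles x y n ↔ δ h f = 0 :=
  mem_cocycles.trans ⟨fun e => Subtype.ext e, fun e => congrArg Subtype.val e⟩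

theorem δ_δ (h : n + 1 = k) (h' : k + 1 = l) (f : A.gr x y n) : δ h' (δ h f) = 0 := by
  have e := m_m_single (⟨n, f⟩ : A.HomogHom x y)
  rw [hm_single_eq h] at e
  exact Subtype.ext e

theorem δ_mem_coboundaries (h : n + 1 = k) (f : A.gr x y n) : δ h f ∈ A.coboundaries x y k :=
  coboundary_of ⟨n, f⟩ h rfl

theorem exists_δ (h : n + 1 = k) {f : A.gr x y k} (hf : f ∈ A.coboundaries x y k) :
    ∃ b : A.gr x y n, δ h b = f := by
  obtain rfl : n = k - 1 := by omega
  obtain ⟨b, hb⟩ := mem_coboundaries.1 hf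
  exact ⟨b, Subtype.ext hb⟩

theorem coboundaries_le_cocycles : A.coboundaries x y n ≤ A.cocycles x y n := by
  intro f hf
  obtain ⟨b, rfl⟩ := exists_δ (sub_add_cancel n 1) hf
  exact (mem_cocycles_iff rfl).2 (δ_δ _ _ b)

theorem cls_eq_zero {f : A.gr x y n} {hf : f ∈ A.cocycles x y n} :
    cls f hf = 0 ↔ f ∈ A.coboundaries x y n :=
  Submodule.Quotient.mk_eq_zero _

/-- The product `m²(g, f)` of homogeneous morphisms. -/
def prod (h : n + k = l) (f : A.gr x y n) (g : A.gr y z k) : A.gr x z l :=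
  ⟨A.m (.cons ⟨n, f⟩ (.single ⟨k, g⟩)), by
    have e : degree (.cons ⟨n, f⟩ (.single ⟨k, g⟩) : A.HChain x z) + 2 -
        Chain.length (.cons ⟨n, f⟩ (.single ⟨k, g⟩) : A.HChain x z) = l := by
      simp [Chain.single, degree, Chain.length]
      omega
    exact e ▸ A.m_mem (.cons ⟨n, f⟩ (.single ⟨k, g⟩))⟩

theorem hm_pair_eq (h : n + k = l) (f : A.gr x y n) (g : A.gr y z k) :
    A.hm (.cons ⟨n, f⟩ (.single ⟨k, g⟩)) = ⟨l, prod h f g⟩ :=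
  homog_ext (by simp [hm, degree, Chain.single, Chain.length]; omega) rfl

theorem zero_prod (h : n + k = l) (g : A.gr y z k) : prod h (0 : A.gr x y n) g = 0 :=
  Subtype.ext (m_cons_zero _ rfl _)

/-- The Leibniz rule for a cocycle of degree `0`. -/
theorem δ_prod {f : A.gr x y 0} (hf : f ∈ A.cocycles x y 0) (h : k + 1 = l) (g : A.gr y z k) :
    δ h (prod (zero_add k) f g) = prod (zero_add l) f (δ h g) := by
  have e := rel_two f g
  rw [hm_pair_eq (zero_add k), hm_single_eq h g, m_cons_zero (A.hm (.single ⟨0, f⟩)) hf] at e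
  simp only [zero_add, zero_sub, Int.negOnePow_neg, Int.negOnePow_one, Units.neg_smul,
    one_smul] at e
  exact Subtype.ext (add_neg_eq_zero.1 e)

end AInfCategory

namespace FormalMorphism

variable {P Q S : GradedQuiver.{u, v} R} {x y z : P.Ob} {n k l : ℤ}

/-- The quadratic part `F²` of a formal morphism. -/
def quad (F : FormalMorphism P Q) (h : n + k - 1 = l) (f : P.gr x y n) (g : P.gr y z k) :
    Q.gr (F.obj x) (F.obj z) l :=
  ⟨F.map (.cons ⟨n, f⟩ (.single ⟨k, g⟩)), by
    have e : degree (.cons ⟨n, f⟩ (.single ⟨k, g⟩) : P.HChain x z) + 1 -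
        Chain.length (.cons ⟨n, f⟩ (.single ⟨k, g⟩) : P.HChain x z) = l := by
      simp [Chain.single, degree, Chain.length]
      omega
    exact e ▸ F.map_mem (.cons ⟨n, f⟩ (.single ⟨k, g⟩))⟩

theorem hmap_pair (F : FormalMorphism P Q) (h : n + k - 1 = l) (f : P.gr x y n)
    (g : P.gr y z k) : F.hmap (.cons ⟨n, f⟩ (.single ⟨k, g⟩)) = ⟨l, F.quad h f g⟩ :=
  homog_ext (by simp [hmap, degree, Chain.single, Chain.length]; omega) rfl

theorem quad_zero (F : FormalMorphism P Q) (h : n + k - 1 = l) (f : P.gr x y n) :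
    F.quad h f (0 : P.gr y z k) = 0 :=
  Subtype.ext (IsMultilinear.map_zero (F.map_multilinear x z) (.single ⟨n, f⟩) k (.nil _))

theorem zero_quad (F : FormalMorphism P Q) (h : n + k - 1 = l) (g : P.gr y z k) :
    F.quad h (0 : P.gr x y n) g = 0 :=
  Subtype.ext (IsMultilinear.map_zero (F.map_multilinear x z) (.nil _) n (.single ⟨k, g⟩))

theorem comp_map_pair (G : FormalMorphism Q S) (F : FormalMorphism P Q) (h : n + k - 1 = l)
    (f : P.gr x y n) (g : P.gr y z k) :
    (G.comp F).map (.cons ⟨n, f⟩ (.single ⟨k, g⟩)) =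
      (G.quad h (F.lin x y n f) (F.lin y z k g) + G.lin _ _ l (F.quad h f g)).1 := by
  have e1 := F.hmap_single ⟨n, f⟩
  have e2 := F.hmap_single ⟨k, g⟩
  have e3 := F.hmap_pair h f g
  simp only [Chain.single] at e1 e2 e3
  simp [comp, Chain.single, Chain.cuts, Chain.growFirst, blocks, Chain.map, e1, e2, e3, quad, lin]

end FormalMorphism

namespace AInfFunctor

variable {A B : AInfCategory.{u, v} R} (F : AInfFunctor A B) {x y z : A.Ob} {n k l : ℤ}

theorem lin_δ (h : n + 1 = k) (f : A.gr x y n) :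
    F.lin x y k (AInfCategory.δ h f) = AInfCategory.δ h (F.lin x y n f) := by
  have e := F.map_rel_one f
  rw [AInfCategory.hm_single_eq h] at e
  exact Subtype.ext e.symm

/-- The `A∞`-relation for `F` on pairs of morphisms, the first one of which is a cocycle of
degree `0`: up to homotopy, `F¹` preserves products. -/
theorem lin_prod {f : A.gr x y 0} (hf : f ∈ A.cocycles x y 0) (h : k + 1 = l) (g : A.gr y z k)
    {j : ℤ} (hj : 0 + k - 1 = j) (hj' : j + 1 = k) (hl : 0 + l - 1 = k) :
    F.lin x z k (AInfCategory.prod (zero_add k) f g) =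
      AInfCategory.prod (zero_add k) (F.lin x y 0 f) (F.lin y z k g) +
        AInfCategory.δ hj' (F.quad hj f g) + F.quad hl f (AInfCategory.δ h g) := by
  have e := F.map_rel (.cons ⟨0, f⟩ (.single ⟨k, g⟩))
  have e1 := F.hmap_single f
  have e2 := F.hmap_single g
  have e3 := F.hmap_pair hj f g
  have e4 := AInfCategory.hm_pair_eq (zero_add k) f g
  have e5 := AInfCategory.hm_single_eq h g
  have hf' : ((A.hm (.cons ⟨0, f⟩ (.nil y))).2 : A.Hom x y) = 0 := hf
  simp only [Chain.single] at e1 e2 e3 e4 e5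
  simp [Chain.splits₃, Chain.splits, Chain.cuts, Chain.growFirst, FormalMorphism.blocks,
    Chain.map, e1, e2, e3, e4, e5, Chain.single, Chain.append, degree, Chain.length,
    F.map_cons_zero _ (AInfCategory.hm_nil _), F.map_cons_cons_zero _ _ (AInfCategory.hm_nil _),
    F.map_cons_cons_cons_zero _ _ _ (AInfCategory.hm_nil _), F.map_cons_zero _ hf'] at e
  exact Subtype.ext (eq_add_of_add_neg_eq e.symm)

end AInfFunctor

namespace AInfCategory

variable {A : AInfCategory.{u, v} R} {x x' y y' : A.Ob} {n k : ℤ}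

theorem castGr_δ (hx : x = x') (hy : y = y') (h : n + 1 = k) (f : A.gr x y n) :
    castGr hx hy (δ h f) = δ h (castGr hx hy f) := by
  subst hx hy
  rfl

theorem castGr_surjective (hx : x = x') (hy : y = y') :
    Function.Surjective (castGr hx hy : A.gr x y n →ₗ[R] _) := by
  subst hx hy
  exact fun f => ⟨f, rfl⟩

theorem castGr_injective (hx : x = x') (hy : y = y') :
    Function.Injective (castGr hx hy : A.gr x y n →ₗ[R] _) := by
  subst hx hy
  exact fun _ _ h => h

theorem castGr_mem_cocycles (hx : x = x') (hy : y = y') {f : A.gr x y n} :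
    castGr hx hy f ∈ A.cocycles x' y' n ↔ f ∈ A.cocycles x y n := by
  subst hx hy
  rfl

theorem castGr_mem_coboundaries (hx : x = x') (hy : y = y') {f : A.gr x y n} :
    castGr hx hy f ∈ A.coboundaries x' y' n ↔ f ∈ A.coboundaries x y n := by
  subst hx hy
  rfl

end AInfCategory

open AInfCategory

/-! ### Gluing cocycles and primitives -/

namespace IsAInfPullback

variable {P A A' A'' : UnitalAInfCategory.{u, v} R} {α : UnitalAInfFunctor P A''}
  {β : UnitalAInfFunctor P A} {F : UnitalAInfFunctor A A'} {G : UnitalAInfFunctor A'' A'}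
  {p q r : P.Ob} {n k : ℤ}

/-- The linear part of `F` on the morphisms over `p` and `q`, with values transported to the
morphisms between the images under `G`. -/
def linF (hP : IsAInfPullback α β F G) (p q : P.Ob) (n : ℤ) :
    A.gr (β.obj p) (β.obj q) n →ₗ[R] A'.gr (G.obj (α.obj p)) (G.obj (α.obj q)) n :=
  castGr (hP.obj_eq p) (hP.obj_eq q) ∘ₗ F.lin _ _ n

theorem linF_β (hP : IsAInfPullback α β F G) (c : P.gr p q n) :
    hP.linF p q n (β.lin p q n c) = G.lin _ _ n (α.lin p q n c) :=
  Subtype.ext (hP.cast_lin c)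

theorem lin_lin_eq_zero (hP : IsAInfPullback α β F G) {c : P.gr p q n}
    (hc : α.lin p q n c = 0) : F.lin _ _ n (β.lin p q n c) = 0 := by
  refine castGr_injective (hP.obj_eq p) (hP.obj_eq q) ?_
  rw [map_zero]
  exact (hP.linF_β c).trans (by rw [hc, map_zero])

theorem linF_δ (hP : IsAInfPullback α β F G) (h : n + 1 = k) (a : A.gr (β.obj p) (β.obj q) n) :
    hP.linF p q k (δ h a) = δ h (hP.linF p q n a) :=
  (congrArg _ (F.lin_δ h a)).trans (castGr_δ _ _ h _)

theorem linF_surjective (hP : IsAInfPullback α β F G) (hF : F.IsSplitSurjective) :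
    Function.Surjective (hP.linF p q n) := by
  intro w
  obtain ⟨w, rfl⟩ := castGr_surjective (hP.obj_eq p) (hP.obj_eq q) w
  obtain ⟨s, hs⟩ := hF (β.obj p) (β.obj q)
  exact ⟨s n w, congrArg (castGr (hP.obj_eq p) (hP.obj_eq q)) (LinearMap.congr_fun (hs n) w)⟩

theorem exists_of_linF_eq (hP : IsAInfPullback α β F G)
    (a : A.gr (β.obj p) (β.obj q) n) (a'' : A''.gr (α.obj p) (α.obj q) n)
    (h : hP.linF p q n a = G.lin _ _ n a'') :
    ∃ c : P.gr p q n, α.lin p q n c = a'' ∧ β.lin p q n c = a :=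
  hP.exists_lin a a'' (congrArg Subtype.val h)

theorem lin_surjective (hP : IsAInfPullback α β F G) (hF : F.IsSplitSurjective) :
    Function.Surjective (α.lin p q n) := by
  intro a''
  obtain ⟨a, ha⟩ := hP.linF_surjective hF (p := p) (q := q) (G.lin _ _ n a'')
  obtain ⟨c, hc, -⟩ := hP.exists_of_linF_eq a a'' ha
  exact ⟨c, hc⟩

/-- Cocycles whose images in `A'` are cohomologous can be glued to a cocycle of the pullback. -/
theorem exists_cocycle (hP : IsAInfPullback α β F G) (hF : F.IsSplitSurjective)
    {a : A.gr (β.obj p) (β.obj q) n}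
    {a'' : A''.gr (α.obj p) (α.obj q) n} (ha : a ∈ A.cocycles _ _ n)
    (ha'' : a'' ∈ A''.cocycles _ _ n)
    (h : hP.linF p q n a - G.lin _ _ n a'' ∈ A'.coboundaries _ _ n) :
    ∃ c ∈ P.cocycles p q n, α.lin p q n c = a'' ∧ β.lin p q n c - a ∈ A.coboundaries _ _ n := by
  obtain ⟨w, hw⟩ := exists_δ (sub_add_cancel n 1) h
  obtain ⟨b, rfl⟩ := hP.linF_surjective hF w
  obtain ⟨c, h1, h2⟩ := hP.exists_of_linF_eq (a - δ (sub_add_cancel n 1) b) a'' (by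
    rw [map_sub, linF_δ, hw, sub_sub_cancel])
  refine ⟨c, (mem_cocycles_iff rfl).2 (hP.lin_ext ?_ ?_), h1, ?_⟩
  · rw [α.lin_δ, h1, (mem_cocycles_iff rfl).1 ha'', map_zero]
  · rw [β.lin_δ, h2, map_sub, δ_δ, (mem_cocycles_iff rfl).1 ha, sub_zero, map_zero]
  · rw [h2, sub_sub_cancel_left]
    exact neg_mem (δ_mem_coboundaries _ _)

/-- A cocycle whose image under `α` is a coboundary is cohomologous to one that `α` kills. -/
theorem exists_lin_sub_δ_eq_zero (hP : IsAInfPullback α β F G)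
    (hF : F.IsSplitSurjective) (h : k + 1 = n) {c : P.gr p q n}
    (hc : α.lin p q n c ∈ A''.coboundaries _ _ n) :
    ∃ b : P.gr p q k, α.lin p q n (c - δ h b) = 0 := by
  obtain ⟨w, hw⟩ := exists_δ h hc
  obtain ⟨b, rfl⟩ := hP.lin_surjective hF w
  exact ⟨b, by rw [map_sub, α.lin_δ, hw, sub_self]⟩

/-- The equality `G · α = F · β` on strings of length `2`, solved for `F¹ β²`. -/
theorem linF_quad (hP : IsAInfPullback α β F G) (f : P.gr p q n) (g : P.gr q r k)
    {l : ℤ} (h : n + k - 1 = l) :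
    hP.linF p r l (β.quad h f g) =
      G.quad h (α.lin _ _ n f) (α.lin _ _ k g) + G.lin _ _ l (α.quad h f g) -
        castGr (hP.obj_eq p) (hP.obj_eq r) (F.quad h (β.lin _ _ n f) (β.lin _ _ k g)) := by
  have e := hP.cast_comp_map (.cons ⟨n, f⟩ (.single ⟨k, g⟩))
  rw [FormalMorphism.comp_map_pair _ _ h, FormalMorphism.comp_map_pair _ _ h] at e
  have e' : castGr (hP.obj_eq p) (hP.obj_eq r)
      (F.quad h (β.lin _ _ n f) (β.lin _ _ k g) + F.lin _ _ l (β.quad h f g)) = _ :=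
    Subtype.ext e
  rw [map_add] at e'
  exact eq_sub_of_add_eq' e'

/-- Auxiliary form of `mul_mem_coboundaries`, in which `α¹ f` vanishes on the nose.  With
`β¹ g = δ w`, the primitive of the product is glued from `α²(g, f)` and
`m²(w, β¹ f) + β²(g, f) - δ z`, where
`F¹ z = F²(w, β¹ f)` makes the two agree in `A'`. -/
theorem mul_mem_coboundaries_of_lin_eq_zero (hP : IsAInfPullback α β F G)
    (hF : F.IsSplitSurjective) {f : P.gr p q 0}
    {g : P.gr q r 0} (hf : f ∈ P.cocycles p q 0) (hg : g ∈ P.cocycles q r 0)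
    (hα : α.lin p q 0 f = 0) (hβ : β.lin q r 0 g ∈ A.coboundaries _ _ 0) :
    P.mul g f ∈ P.coboundaries p r 0 := by
  obtain ⟨w, hw⟩ := exists_δ (neg_add_cancel 1) hβ
  have hf0 : F.lin _ _ 0 (β.lin p q 0 f) = 0 := hP.lin_lin_eq_zero hα
  have hβf := β.lin_mem_cocycles hf
  obtain ⟨z, hz⟩ := hP.linF_surjective hF (p := p) (q := r) (n := -2)
    (castGr (hP.obj_eq p) (hP.obj_eq r) (F.quad (by norm_num) (β.lin _ _ 0 f) w))
  have hFw := F.lin_prod hβf (neg_add_cancel 1) w (j := -2) (by norm_num) (by norm_num)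
    (by norm_num)
  rw [hf0, zero_prod, zero_add, hw] at hFw
  have hβ2 := β.lin_prod hf (zero_add 1) g (j := -1) (by norm_num) (by norm_num) (by norm_num)
  have hα2 := α.lin_prod hf (zero_add 1) g (j := -1) (by norm_num) (by norm_num) (by norm_num)
  rw [(mem_cocycles_iff (zero_add 1)).1 hg, FormalMorphism.quad_zero, add_zero] at hα2 hβ2
  rw [hα, zero_prod, zero_add] at hα2
  obtain ⟨c, h1, h2⟩ := hP.exists_of_linF_eq (p := p) (q := r) (n := -1)
    (prod (zero_add (-1)) (β.lin _ _ 0 f) w + β.quad (by norm_num) f g -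
      δ (by norm_num) z) (α.quad (by norm_num) f g) (by
    rw [map_sub, map_add, linF_δ, hz, linF_quad, hα, FormalMorphism.zero_quad]
    have e := congrArg (castGr (hP.obj_eq p) (hP.obj_eq r)) hFw
    rw [map_add, castGr_δ] at e
    rw [show hP.linF p r (-1) (prod (zero_add (-1)) (β.lin _ _ 0 f) w) = _ from e]
    abel)
  have e : P.mul g f = δ (neg_add_cancel 1) c := by
    refine hP.lin_ext ?_ ?_
    · rw [α.lin_δ, h1]
      exact hα2
    · rw [β.lin_δ, h2, map_sub, map_add, δ_δ, sub_zero, δ_prod hβf, hw]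
      exact hβ2
  exact e ▸ δ_mem_coboundaries _ _

end IsAInfPullback

/-! ### Isomorphisms in degree zero -/

namespace AInfCategory

variable {A : AInfCategory.{u, v} R} {x x' y y' : A.Ob} {n k : ℤ}

theorem cls_congr {f g : A.gr x y n} {hf : f ∈ A.cocycles x y n} (h : f = g) :
    cls f hf = cls g (h ▸ hf) := by
  subst h
  rfl

end AInfCategory

namespace UnitalAInfCategory

variable {A : UnitalAInfCategory.{u, v} R}

theorem comp_eq_cls {x y z : A.Ob} {g : A.gr y z 0} {f : A.gr x y 0} (hg : g ∈ A.cocycles y z 0)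
    (hf : f ∈ A.cocycles x y 0) :
    (show (⟨x⟩ : A.H0) ⟶ ⟨y⟩ from cls f hf) ≫ (show (⟨y⟩ : A.H0) ⟶ ⟨z⟩ from cls g hg) =
      cls (A.mul g f) (mul_mem_cocycles hg hf) := rfl

theorem mul_one_right {x y : A.Ob} (f : A.gr x y 0) : A.mul f (A.one x) = f :=
  Subtype.ext (A.m_one_right 0 f)

theorem mul_one_left {x y : A.Ob} (f : A.gr x y 0) : A.mul (A.one y) f = f :=
  Subtype.ext ((A.m_one_left 0 f).trans (by simp))

/-- Conjugation with `eqToHom` in `H⁰` is transport of representatives. -/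
theorem eqToHom_comp_cls {x x' y y' : A.Ob} (hx : x = x') (hy : y = y') (ex : (⟨x'⟩ : A.H0) = ⟨x⟩)
    (ey : (⟨y⟩ : A.H0) = ⟨y'⟩) {f : A.gr x y 0} (hf : f ∈ A.cocycles x y 0) :
    eqToHom ex ≫ (show (⟨x⟩ : A.H0) ⟶ ⟨y⟩ from cls f hf) ≫ eqToHom ey =
      cls (castGr hx hy f) ((castGr_mem_cocycles hx hy).2 hf) := by
  subst hx hy
  simp only [eqToHom_refl, Category.id_comp, Category.comp_id]
  rfl

/-- If `e - 1` squares to zero in cohomology, then `e` is an isomorphism with inverse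
`1 - (e - 1)`. -/
theorem isIso_of_mul_sub_one {x : A.Ob} {e : A.gr x x 0} (he : e ∈ A.cocycles x x 0)
    (h : A.mul (e - A.one x) (e - A.one x) ∈ A.coboundaries x x 0) :
    IsIso (show (⟨x⟩ : A.H0) ⟶ ⟨x⟩ from cls e he) := by
  have h1 := A.one_mem_cocycles x
  have h' : A.one x - (e - A.one x) ∈ A.cocycles x x 0 := sub_mem h1 (sub_mem he h1)
  refine ⟨(show (⟨x⟩ : A.H0) ⟶ ⟨x⟩ from cls _ h'), ?_, ?_⟩
  · refine (comp_eq_cls h' he).trans (cls_eq.2 ?_)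
    rw [← neg_mem_iff]
    convert h using 1
    simp only [mul_sub_left, mul_sub_right, mul_one_left, mul_one_right]
    abel
  · refine (comp_eq_cls he h').trans (cls_eq.2 ?_)
    rw [← neg_mem_iff]
    convert h using 1
    simp only [mul_sub_left, mul_sub_right, mul_one_left, mul_one_right]
    abel

end UnitalAInfCategory

open UnitalAInfCategory

namespace IsAInfPullback

variable {P A A' A'' : UnitalAInfCategory.{u, v} R} {α : UnitalAInfFunctor P A''}
  {β : UnitalAInfFunctor P A} {F : UnitalAInfFunctor A A'} {G : UnitalAInfFunctor A'' A'}
  {p q r : P.Ob} {n k : ℤ}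

/-- If the class of `f` becomes zero in `A''` and the class of `g` becomes zero in `A`, then the
product of `g` and `f` is zero in cohomology. -/
theorem mul_mem_coboundaries (hP : IsAInfPullback α β F G) (hF : F.IsSplitSurjective)
    {f : P.gr p q 0} {g : P.gr q r 0} (hf : f ∈ P.cocycles p q 0) (hg : g ∈ P.cocycles q r 0)
    (hα : α.lin p q 0 f ∈ A''.coboundaries _ _ 0) (hβ : β.lin q r 0 g ∈ A.coboundaries _ _ 0) :
    P.mul g f ∈ P.coboundaries p r 0 := by
  obtain ⟨b, hb⟩ := hP.exists_lin_sub_δ_eq_zero hF (neg_add_cancel 1) hα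
  have hδ := δ_mem_coboundaries (neg_add_cancel 1) b
  have h1 := hP.mul_mem_coboundaries_of_lin_eq_zero hF
    (sub_mem hf (coboundaries_le_cocycles hδ)) hg hb hβ
  rw [mul_sub_right] at h1
  exact (Submodule.sub_mem_iff_left _ (mul_mem_coboundaries_right hg hδ)).1 h1

theorem isIso_of_map_eq_id (hP : IsAInfPullback α β F G) (hF : F.IsSplitSurjective) {p : P.H0}
    (e : p ⟶ p) (hα : α.H0map.map e = 𝟙 _) (hβ : β.H0map.map e = 𝟙 _) : IsIso e := by
  obtain ⟨e, he, rfl⟩ := exists_cls e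
  have h1 := P.one_mem_cocycles p.ob
  have hu := sub_mem he h1
  refine isIso_of_mul_sub_one he (hP.mul_mem_coboundaries hF hu hu ?_ ?_)
  · have h := cls_eq.1 (hα.trans (α.H0map.map_id p).symm)
    rwa [map_sub]
  · have h := cls_eq.1 (hβ.trans (β.H0map.map_id p).symm)
    rwa [map_sub]

/-! ### Base change of isofibrations and quasi-equivalences -/

theorem isH0Isofibration (hP : IsAInfPullback α β F G) (hF : F.IsSplitSurjective)
    (hF2 : F.IsH0Isofibration) : α.IsH0Isofibration := by
  rintro ⟨p⟩ ⟨b⟩ φ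
  have hp : F.H0map.obj ⟨β.obj p⟩ = G.H0map.obj ⟨α.obj p⟩ := congrArg H0.mk (hP.obj_eq p)
  obtain ⟨⟨x'⟩, ψ, h, hψ⟩ := hF2 ⟨β.obj p⟩ ⟨G.obj b⟩ (eqToIso hp ≪≫ G.H0map.mapIso φ)
  obtain ⟨p', h1, h2⟩ := hP.exists_obj (congrArg H0.ob h)
  subst h1 h2
  have hiso : eqToIso hp.symm ≪≫ F.H0map.mapIso ψ ≪≫ eqToIso h = G.H0map.mapIso φ := by
    ext
    change eqToHom hp.symm ≫ F.H0map.map ψ.hom ≫ eqToHom h = _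
    rw [hψ]
    exact (eqToIso hp).inv_hom_id_assoc _
  have hhom : eqToHom hp.symm ≫ F.H0map.map ψ.hom ≫ eqToHom h = G.H0map.map φ.hom :=
    congrArg Iso.hom hiso
  have hinv : eqToHom h.symm ≫ F.H0map.map ψ.inv ≫ eqToHom hp = G.H0map.map φ.inv := by
    have := congrArg Iso.inv hiso
    simpa using this
  -- a pair of morphisms of `H⁰(A)` and `H⁰(A'')` with the same image in `H⁰(A')` lifts to `H⁰(P)`
  have key : ∀ {p q : P.Ob} (s : (⟨β.obj p⟩ : A.H0) ⟶ ⟨β.obj q⟩)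
      (t : (⟨α.obj p⟩ : A''.H0) ⟶ ⟨α.obj q⟩)
      (ep : G.H0map.obj ⟨α.obj p⟩ = F.H0map.obj ⟨β.obj p⟩)
      (eq : F.H0map.obj ⟨β.obj q⟩ = G.H0map.obj ⟨α.obj q⟩),
      eqToHom ep ≫ F.H0map.map s ≫ eqToHom eq = G.H0map.map t →
      ∃ f : (⟨p⟩ : P.H0) ⟶ ⟨q⟩, α.H0map.map f = t ∧ β.H0map.map f = s := by
    intro p q s t ep eq hst
    obtain ⟨a, ha, rfl⟩ := exists_cls s
    obtain ⟨a'', ha'', rfl⟩ := exists_cls t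
    have e := (eqToHom_comp_cls (hP.obj_eq p) (hP.obj_eq q) ep eq
      (F.lin_mem_cocycles ha)).symm.trans hst
    obtain ⟨c, hc, h1, h2⟩ := hP.exists_cocycle hF ha ha'' (cls_eq.1 e)
    exact ⟨cls c hc, cls_congr h1, cls_eq.2 h2⟩
  obtain ⟨f, hf1, hf2⟩ := key ψ.hom φ.hom hp.symm h hhom
  obtain ⟨g, hg1, hg2⟩ := key ψ.inv φ.inv h.symm hp hinv
  have hfg : IsIso (f ≫ g) := hP.isIso_of_map_eq_id hF _
    (by rw [Functor.map_comp, hf1, hg1]; exact φ.hom_inv_id)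
    (by rw [Functor.map_comp, hf2, hg2]; exact ψ.hom_inv_id)
  have hgf : IsIso (g ≫ f) := hP.isIso_of_map_eq_id hF _
    (by rw [Functor.map_comp, hf1, hg1]; exact φ.inv_hom_id)
    (by rw [Functor.map_comp, hf2, hg2]; exact ψ.inv_hom_id)
  have hf : IsIso f := by
    have : IsSplitMono f := ⟨⟨⟨g ≫ inv (f ≫ g), by rw [← Category.assoc, IsIso.hom_inv_id]⟩⟩⟩
    have : Epi f := by
      have : Epi (g ≫ f) := inferInstance
      exact epi_of_epi g f
    exact isIso_of_epi_of_isSplitMono f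
  exact ⟨⟨p'⟩, asIso f, rfl, (Category.comp_id _).trans hf1⟩

theorem Hmap_injective (hP : IsAInfPullback α β F G) (hF : F.IsSplitSurjective)
    (hQ : F.IsQuasiEquivalence) (p q : P.Ob) (n : ℤ) : Function.Injective (α.Hmap p q n) := by
  rw [injective_iff_map_eq_zero]
  intro a ha
  obtain ⟨c, hc, rfl⟩ := exists_cls a
  rw [α.Hmap_cls, cls_eq_zero] at ha
  have hn := sub_add_cancel n 1
  obtain ⟨b, hb⟩ := hP.exists_lin_sub_δ_eq_zero hF hn ha
  have hc' := sub_mem hc (coboundaries_le_cocycles (δ_mem_coboundaries hn b))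
  refine cls_eq_zero.2 ((Submodule.sub_mem_iff_left _ (δ_mem_coboundaries hn b)).1 ?_)
  generalize c - δ hn b = c at hb hc'
  have h0 : F.lin _ _ n (β.lin p q n c) = 0 := hP.lin_lin_eq_zero hb
  have h1 : β.lin p q n c ∈ A.coboundaries _ _ n := by
    rw [← cls_eq_zero (hf := β.lin_mem_cocycles hc')]
    refine (hQ.1 _ _ n).1 ?_
    rw [F.Hmap_cls, map_zero, cls_eq_zero, h0]
    exact zero_mem _
  obtain ⟨b', hb'⟩ := exists_δ hn h1
  have h2 : F.lin _ _ _ b' ∈ A'.cocycles _ _ (n - 1) := by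
    rw [mem_cocycles_iff hn, ← F.lin_δ, hb', h0]
  -- since `F¹ β¹ c = 0`, the image of the primitive `b'` in `A'` is a cocycle
  obtain ⟨s, hs⟩ := (hQ.1 _ _ (n - 1)).2 (cls _ h2)
  obtain ⟨b₁, hb₁, rfl⟩ := exists_cls s
  have h3 : hP.linF p q (n - 1) (b₁ - b') ∈ A'.coboundaries _ _ (n - 1) := by
    rw [linF, LinearMap.comp_apply, map_sub]
    exact (castGr_mem_coboundaries (hP.obj_eq p) (hP.obj_eq q)).2 (cls_eq.1 hs)
  obtain ⟨w, hw⟩ := exists_δ (sub_add_cancel (n - 1) 1) h3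
  obtain ⟨z, rfl⟩ := hP.linF_surjective hF w
  -- `b₁` and `z` correct `b'` to a primitive of `β¹ c` that `F¹` kills
  obtain ⟨e, he1, he2⟩ := hP.exists_of_linF_eq
    (b' + (δ (sub_add_cancel (n - 1) 1) z - b₁)) 0 (by
      rw [map_add, map_sub, linF_δ, hw, map_sub, map_zero]
      abel)
  have : c = δ hn e := by
    refine hP.lin_ext ?_ ?_
    · rw [α.lin_δ, he1, hb, map_zero]
    · rw [β.lin_δ, he2, map_add, map_sub, δ_δ, (mem_cocycles_iff hn).1 hb₁, hb', sub_zero,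
        add_zero]
  exact this ▸ δ_mem_coboundaries hn e

theorem Hmap_surjective (hP : IsAInfPullback α β F G) (hF : F.IsSplitSurjective)
    (hQ : F.IsQuasiEquivalence) (p q : P.Ob) (n : ℤ) : Function.Surjective (α.Hmap p q n) := by
  intro a''
  obtain ⟨a'', ha'', rfl⟩ := exists_cls a''
  obtain ⟨w, hw⟩ := castGr_surjective (hP.obj_eq p) (hP.obj_eq q) (G.lin _ _ n a'')
  have hwc : w ∈ A'.cocycles _ _ n :=
    (castGr_mem_cocycles (hP.obj_eq p) (hP.obj_eq q)).1 (hw ▸ G.lin_mem_cocycles ha'')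
  obtain ⟨s, hs⟩ := (hQ.1 _ _ n).2 (cls w hwc)
  obtain ⟨a, ha, rfl⟩ := exists_cls s
  have h := (castGr_mem_coboundaries (hP.obj_eq p) (hP.obj_eq q)).2 (cls_eq.1 hs)
  rw [map_sub, hw] at h
  obtain ⟨c, hc, h1, -⟩ := hP.exists_cocycle hF ha ha'' h
  exact ⟨cls c hc, cls_congr h1⟩

theorem isQuasiEquivalence (hP : IsAInfPullback α β F G) (hF : F.IsSplitSurjective)
    (hF2 : F.IsH0Isofibration) (hQ : F.IsQuasiEquivalence) : α.IsQuasiEquivalence := by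
  refine ⟨fun p q n => ⟨hP.Hmap_injective hF hQ p q n, hP.Hmap_surjective hF hQ p q n⟩, ⟨?_⟩⟩
  rintro ⟨b⟩
  obtain ⟨x, ⟨φ⟩⟩ := hQ.2.mem_essImage (⟨G.obj b⟩ : A'.H0)
  obtain ⟨⟨x'⟩, -, h, -⟩ := hF2 x ⟨G.obj b⟩ φ
  obtain ⟨p, rfl, -⟩ := hP.exists_obj (congrArg H0.ob h)
  exact ⟨⟨p⟩, ⟨Iso.refl _⟩⟩

end IsAInfPullback

end AInfinity

theorem theoremC {R : Type v} [CommRing R]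
    {A A' A'' P : AInfinity.UnitalAInfCategory.{u, v} R}
    (F : AInfinity.UnitalAInfFunctor A A') (G : AInfinity.UnitalAInfFunctor A'' A')
    (hF : F.IsSplitSurjective)
    (α : AInfinity.UnitalAInfFunctor P A'') (β : AInfinity.UnitalAInfFunctor P A)
    (hP : AInfinity.IsAInfPullback α β F G)
    (hF2 : F.IsH0Isofibration) :
    α.IsH0Isofibration ∧ (F.IsQuasiEquivalence → α.IsQuasiEquivalence) := by
  exact ⟨hP.isH0Isofibration hF hF2, hP.isQuasiEquivalence hF hF2⟩
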